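/- Let $\Sigma$ be an alphabet of constant size $\sigma$. A pattern $\alpha$ is a nonempty string of letters of $\Sigma$ and variables; a substitution $h$ maps variables to (possibly empty) words over $\Sigma$, and $h(\alpha)$ is the word obtained by replacing every variable $x$ in $\alpha$ by $h(x)$. For words $u,v$ of equal length, $d(u,v)$ is their Hamming distance, and $d(\alpha,w)=\min\{d(h(\alpha),w)\mid h \text{ a substitution with } |h(\alpha)|=|w|\}$ (with $\min\emptyset=\infty$). In the problem $\mathtt{MinMisMatch}_{\mathtt{1RepVar}}$ one is given a word $w\in\Sigma^*$ of length $n$ and a pattern $\alpha$ of length at most $n$, with variables among $x_1,\dots,x_n$, in which at most one variable occurs more than once, and has to compute $d(\alpha,w)$. Time is measured on a unit-cost RAM whose words hold $O(\log n)$ bits; letters and variables are given as integers, one per memory cell. Theorem. For each constant $r\ge 3$ there is an algorithm that runs in time $O(n^{r+3})$ (the implied constant depending only on $r$ and $\sigma$) and that, on every such input $(\alpha,w)$, outputs $\infty$ if $d(\alpha,w)=\infty$, and otherwise outputs the distance $d(h(\alpha),w)$ of some substitution $h$ with $|h(\alpha)|=|w|$ such that $$d(h(\alpha),w)\le \min\left\{2,\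 1+\frac{4\sigma-4}{\sqrt e\,(\sqrt{4r+1}-3)}\right\}\, d(\alpha,w).$$ Consequently the problem has a polynomial-time approximation scheme: for every $\varepsilon>0$ there are a $k\in\mathbb N$ and an algorithm running in time $O(n^k)$ with the same property for the ratio $1+\varepsilon$ in place of the minimum above. -/

import Mathlib

/-! ### Words, patterns and the Hamming distance between a pattern and a word -/

/-- A word over the terminal alphabet with `σ` letters. -/
abbrev PWord (σ : ℕ) : Type := List (Fin σ)

/-- A string of terminal letters (`Sum.inl a`) and variables (`Sum.inr x`). A pattern is a
nonempty such string. -/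
abbrev Pattern (σ : ℕ) : Type := List (Fin σ ⊕ ℕ)

/-- `h(α)`: every occurrence of a variable `x` is replaced by `h x`. Only the values of `h` on the
variables of `α` matter. -/
def Pattern.subst {σ : ℕ} (h : ℕ → PWord σ) (α : Pattern σ) : PWord σ :=
  α.flatMap (Sum.elim (fun a => [a]) h)

/-- At most one variable occurs more than once. -/
def Pattern.IsOneRepVar {σ : ℕ} (α : Pattern σ) : Prop :=
  ∀ x y : ℕ, 1 < α.count (Sum.inr x) → 1 < α.count (Sum.inr y) → x = y

/-- The number of mismatches; used for words of equal length only. -/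
def wordDist {σ : ℕ} (u v : PWord σ) : ℕ :=
  (u.zip v).countP (fun p => p.1 ≠ p.2)

/-- The minimum of `wordDist (h(α)) w` over all substitutions `h` with `|h(α)| = |w|`; it is `⊤`
if there is no such substitution. -/
noncomputable def patDist {σ : ℕ} (α : Pattern σ) (w : PWord σ) : ℕ∞ :=
  ⨅ (h : ℕ → PWord σ) (_ : (α.subst h).length = w.length), (wordDist (α.subst h) w : ℕ∞)

/-! ### A unit-cost random access machine with bounded word size -/

/-- Arithmetic and bitwise operations on memory words. -/
inductive BinOp : Type
  | add | sub | mul | div | mod | land | lor | xor | shiftLeft | shiftRight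

/-- Subtraction is truncated at `0`, and division is rounded down. -/
def BinOp.eval : BinOp → ℕ → ℕ → ℕ
  | .add, a, b => a + b
  | .sub, a, b => a - b
  | .mul, a, b => a * b
  | .div, a, b => a / b
  | .mod, a, b => a % b
  | .land, a, b => a &&& b
  | .lor, a, b => a ||| b
  | .xor, a, b => a ^^^ b
  | .shiftLeft, a, b => a <<< b
  | .shiftRight, a, b => a >>> b

/-- Comparisons of two registers. -/
inductive RamTest : Type
  | lt (a b : ℕ)
  | eq (a b : ℕ)

/-- Structured RAM programs. Arguments `d`, `a`, `b` are numbers of registers, of which a program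
uses finitely many; `load` and `store` address the memory indirectly through a register. -/
inductive RamProg : Type
  | skip
  | const (d k : ℕ)
  | op (f : BinOp) (d a b : ℕ)
  | load (d a : ℕ)
  | store (a b : ℕ)
  | seq (p q : RamProg)
  | ite (t : RamTest) (p q : RamProg)
  | while (t : RamTest) (p : RamProg)

/-- The contents of the registers and of the memory cells. -/
structure RamState : Type where
  reg : ℕ → ℕ
  mem : ℕ → ℕ

def RamTest.Holds (s : RamState) : RamTest → Prop
  | .lt a b => s.reg a < s.reg b
  | .eq a b => s.reg a = s.reg b

def RamState.setReg (s : RamState) (d v : ℕ) : RamState :=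
  { s with reg := Function.update s.reg d v }

def RamState.setMem (s : RamState) (i v : ℕ) : RamState :=
  { s with mem := Function.update s.mem i v }

/-- `RamRun W p s k s'`: on a machine whose words hold the numbers smaller than `W`, the program
`p`, started in the state `s`, halts in the state `s'` after `k` steps. Every elementary instruction
and every evaluation of a test is one step. An instruction that would write a number that does not
fit into a word cannot be executed: there is then no halting run. -/
inductive RamRun (W : ℕ) : RamProg → RamState → ℕ → RamState → Prop
  | skip (s : RamState) : RamRun W .skip s 1 s
  | const (s : RamState) (d k : ℕ) (hk : k < W) :
      RamRun W (.const d k) s 1 (s.setReg d k)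
  | op (s : RamState) (f : BinOp) (d a b : ℕ) (hf : f.eval (s.reg a) (s.reg b) < W) :
      RamRun W (.op f d a b) s 1 (s.setReg d (f.eval (s.reg a) (s.reg b)))
  | load (s : RamState) (d a : ℕ) (ha : s.reg a < W) (hv : s.mem (s.reg a) < W) :
      RamRun W (.load d a) s 1 (s.setReg d (s.mem (s.reg a)))
  | store (s : RamState) (a b : ℕ) (ha : s.reg a < W) (hv : s.reg b < W) :
      RamRun W (.store a b) s 1 (s.setMem (s.reg a) (s.reg b))
  | seq {p q : RamProg} {s s' s'' : RamState} {k l : ℕ}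
      (hp : RamRun W p s k s') (hq : RamRun W q s' l s'') :
      RamRun W (.seq p q) s (k + l) s''
  | ite_true {t : RamTest} {p q : RamProg} {s s' : RamState} {k : ℕ}
      (ht : t.Holds s) (hp : RamRun W p s k s') :
      RamRun W (.ite t p q) s (k + 1) s'
  | ite_false {t : RamTest} {p q : RamProg} {s s' : RamState} {k : ℕ}
      (ht : ¬ t.Holds s) (hq : RamRun W q s k s') :
      RamRun W (.ite t p q) s (k + 1) s'
  | while_true {t : RamTest} {p : RamProg} {s s' s'' : RamState} {k l : ℕ}
      (ht : t.Holds s) (hp : RamRun W p s k s') (hl : RamRun W (.while t p) s' l s'') :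
      RamRun W (.while t p) s (k + l + 1) s''
  | while_false {t : RamTest} {p : RamProg} {s : RamState} (ht : ¬ t.Holds s) :
      RamRun W (.while t p) s 1 s

/-! ### Algorithms for the minimisation problem -/

/-- Terminal letters are the integers `1, …, σ`; variables are the integers from `σ + 1` on. -/
def symCode {σ : ℕ} : Fin σ ⊕ ℕ → ℕ
  | .inl a => a.val + 1
  | .inr x => σ + 1 + x

/-- The input: registers `0` and `1` hold `|w|` and `|α|`; the memory holds the symbols of `w`
followed by those of `α`, one per cell; everything else is `0`. -/
def inputState {σ : ℕ} (α : Pattern σ) (w : PWord σ) : RamState where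
  reg := fun i => if i = 0 then w.length else if i = 1 then α.length else 0
  mem := fun i => ((w.map (fun a => symCode (Sum.inl a))) ++ α.map symCode).getD i 0

/-- The output `out` is acceptable with approximation ratio `ρ`: if no image of `α` has the length
of `w`, the answer is `∞`, which is written as `0`; otherwise the answer is the distance
`d = d(h(α), w)` of some substitution `h`, with `d ≤ ρ · d(α, w)`, and it is written as `d + 1`. -/
def IsApproxOutput {σ : ℕ} (ρ : ℝ) (α : Pattern σ) (w : PWord σ) (out : ℕ) : Prop :=
  (patDist α w = ⊤ ∧ out = 0) ∨
    ∃ h : ℕ → PWord σ, (α.subst h).length = w.length ∧ out = wordDist (α.subst h) w + 1 ∧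
      (wordDist (α.subst h) w : ℝ) ≤ ρ * ((patDist α w).toNat : ℝ)

/-- Over the alphabet with `σ` letters, some RAM program computes in time `O(n ^ k)` an answer to
the minimisation problem for one-repeated-variable patterns with approximation ratio at most `ρ`.
Instances consist of a word of length `n` and a pattern of length at most `n` with variables among
`x_0, …, x_{n-1}`. A word of the machine holds `O(log n)` bits, i.e., the numbers below
`(n + 1) ^ c` for a constant `c`. The answer is found in register `0`. -/
def HasApproxAlgorithm (σ : ℕ) (ρ : ℝ) (k : ℕ) : Prop :=
  ∃ (P : RamProg) (c C : ℕ), ∀ (α : Pattern σ) (w : PWord σ),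
    α ≠ [] → α.length ≤ w.length → (∀ x : ℕ, Sum.inr x ∈ α → x < w.length) → α.IsOneRepVar →
      ∃ (t : ℕ) (s : RamState), t ≤ C * w.length ^ k ∧
        RamRun ((w.length + 1) ^ c) P (inputState α w) t s ∧ IsApproxOutput ρ α w (s.reg 0)

/-! ### Majority votes of random samples -/

/-! Let `x` be the repeated variable. Once the value of `x` is fixed, the pattern is regular, and
the distance is computed by a row-by-row dynamic program in which a letter updates one row and a
variable occurring once takes prefix minima. It remains to guess the value of `x`.

In an optimal solution the occurrences of `x` are matched with factors of `w` of a common length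
`l`. With these positions fixed, the cost splits into a part independent of the value of `x` and a
sum over the offsets `j < l` of the number of factors whose `j`-th letter differs from that of the
value (`exists_occurrences`). A columnwise majority would be optimal, but there may be too many
positions to guess. Instead `r` of them are guessed, with repetition, and the columnwise majority of
these `r` factors is used.

For a uniformly random sample the expected cost of a column is controlled by
`sum_card_ne_majority_le`. Let `b` be the most frequent letter of the column and `a` another letter,
rarer by a fraction `δ` of the entries. If `a` is at least as frequent as `b` in the sample, then at
least half of the sample differs from `b`, so up to a factor 2 a given draw does as well
(`card_tie_le`). This brings in the optimal cost of the column as a factor. The other `r - 1` draws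
are nearly tied, which has probability exponentially small in `δ` by a Chernoff bound
(`card_near_tie_le`). The loss when `a` wins is proportional to `δ`, and maximising `δ` times the
tail gives the constant (`tail_constant_le`). The ratio 2 comes from samples that repeat a single
position (`sum_card_ne_le_two_mul`). Expectations add over columns, so one sample is good for all
columns at once (`exists_sample`).

A number below `(n + 1) ^ (r + 1)` encodes the length and the `r` positions. Every such number
yields a genuine value of `x`, so no candidate undercuts the true minimum, and the encoding of a
good sample achieves the ratio (`isApproxOutput_bestDist`). Only candidates with `l * m ≤ n` are
evaluated, where `m` counts the occurrences of `x`. All occurrences then contribute at most `n`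
letter updates, so a candidate takes `O(n ^ 2)` steps and the search `O(n ^ (r + 3))`. The rest
verifies a RAM program with this running time. The ratio tends to 1 as `r` grows, which gives the
approximation scheme. -/

open Finset in
/-- The number of entries of `c` that are equal to `a`. -/
def voteCount {ι κ : Type*} [Fintype ι] [DecidableEq κ] (c : ι → κ) (a : κ) : ℕ :=
  #{i | c i = a}

section Sampling

open Finset Real

variable {ι κ : Type*} [Fintype ι] [DecidableEq κ]

/-- Hoeffding's lemma for the uniform distribution on `ι`: a variable with values in `[-1, 1]` is
sub-Gaussian with variance proxy 1 about its mean. -/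
theorem sum_exp_mul_le [Nonempty ι] (Y : ι → ℝ) (hY : ∀ k, Y k ∈ Set.Icc (-1 : ℝ) 1) (t : ℝ) :
    ∑ k, exp (t * Y k) ≤
      Fintype.card ι * exp (t * ((∑ k, Y k) / Fintype.card ι) + t ^ 2 / 2) := by
  classical
  let _ : MeasurableSpace ι := ⊤
  have : MeasurableSingletonClass ι := ⟨fun _ => trivial⟩
  set μ : MeasureTheory.Measure ι := ProbabilityTheory.uniformOn Set.univ with hμ
  have hm : (0 : ℝ) < Fintype.card ι := by exact_mod_cast Fintype.card_pos
  have hint : ∀ f : ι → ℝ, ∫ k, f k ∂μ = (∑ k, f k) / Fintype.card ι := by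
    intro f
    rw [MeasureTheory.integral_fintype .of_finite, Finset.sum_div]
    refine Finset.sum_congr rfl fun k _ => ?_
    rw [MeasureTheory.measureReal_def, hμ, ProbabilityTheory.uniformOn_univ]
    simp
    ring
  have h := (ProbabilityTheory.hasSubgaussianMGF_of_mem_Icc (μ := μ) (X := Y) (a := -1) (b := 1)
    (Measurable.of_discrete).aemeasurable (Filter.Eventually.of_forall hY)).mgf_le t
  rw [ProbabilityTheory.mgf, hint, hint] at h
  set δ := (∑ k, Y k) / (Fintype.card ι : ℝ)
  have e1 : ∀ k, exp (t * Y k) = exp (t * δ) * exp (t * (Y k - δ)) := by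
    intro k; rw [← exp_add]; ring_nf
  simp_rw [e1]
  rw [← Finset.mul_sum, exp_add]
  rw [div_le_iff₀ hm] at h
  have e2 : ((((‖(1 : ℝ) - -1‖₊ / 2) ^ 2 : NNReal) : ℝ) * t ^ 2 / 2) = t ^ 2 / 2 := by
    have : ‖(1 : ℝ) - -1‖ = 2 := by norm_num
    push_cast
    rw [this]; ring
  rw [e2] at h
  calc _ ≤ exp (t * δ) * (exp (t ^ 2 / 2) * Fintype.card ι) := by gcongr
    _ = _ := by ring

theorem sum_sub_indicator (c : ι → κ) (a b : κ) :
    ∑ i, ((if c i = a then (1 : ℝ) else 0) - (if c i = b then 1 else 0)) =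
      (voteCount c a : ℝ) - voteCount c b := by
  simp [voteCount, Finset.sum_sub_distrib]

/-- Chernoff bound for the event that `a` is nearly as frequent as `b` in a sample. -/
theorem card_near_tie_le [Nonempty ι] (g : ι → κ) (a b : κ) (N : ℕ) (t : ℝ) (ht : 0 ≤ t) :
    (#{s : Fin N → ι | voteCount (g ∘ s) b ≤ voteCount (g ∘ s) a + 1} : ℝ) ≤
      (Fintype.card ι : ℝ) ^ N *
        exp (t - t * N * (((voteCount g b : ℝ) - voteCount g a) / Fintype.card ι)
          + N * (t ^ 2 / 2)) := by
  classical
  set Y : ι → ℝ := fun k => (if g k = a then (1 : ℝ) else 0) - (if g k = b then 1 else 0) with hYd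
  have hY : ∀ k, Y k ∈ Set.Icc (-1 : ℝ) 1 := by
    intro k
    simp only [hYd, Set.mem_Icc]
    split_ifs <;> norm_num
  -- Markov's inequality: on a near tie the sum of the `Y (s i)` is at least `-1`, so `exp t` times
  -- the product of exponentials is at least 1.
  have h1 : (#{s : Fin N → ι | voteCount (g ∘ s) b ≤ voteCount (g ∘ s) a + 1} : ℝ) ≤
      ∑ s : Fin N → ι, exp t * ∏ i, exp (t * Y (s i)) := by
    rw [Finset.card_filter]
    push_cast
    refine Finset.sum_le_sum fun s _ => ?_
    rw [← exp_sum, ← exp_add, ← Finset.mul_sum]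
    split_ifs with h
    · rw [one_le_exp_iff]
      have := sum_sub_indicator (g ∘ s) a b
      simp only [Function.comp] at this
      simp only [hYd]
      rw [this]
      have h' : (voteCount (g ∘ s) b : ℝ) ≤ voteCount (g ∘ s) a + 1 := by exact_mod_cast h
      simp only [Function.comp_def] at h' ⊢
      nlinarith
    · positivity
  refine h1.trans ?_
  -- Independence of the draws: the sum over samples of a product is a power of a single sum.
  rw [← Finset.mul_sum, ← Fintype.sum_pow (fun k => exp (t * Y k))]
  have h2 := sum_exp_mul_le Y hY t
  rw [show ∑ k, Y k = (voteCount g a : ℝ) - voteCount g b from sum_sub_indicator g a b] at h2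
  calc _ ≤ exp t * (Fintype.card ι * exp (t * (((voteCount g a : ℝ) - voteCount g b)
            / Fintype.card ι) + t ^ 2 / 2)) ^ N := by gcongr
    _ = _ := by
      rw [mul_pow, ← exp_nat_mul, mul_left_comm, ← exp_add]
      ring_nf

theorem voteCount_insertNth {α : Type*} {N : ℕ} (g : α → κ) (i : Fin (N + 1)) (k : α)
    (s : Fin N → α) (a : κ) :
    voteCount (g ∘ (i.insertNth k s : Fin (N + 1) → α)) a =
      (if g k = a then 1 else 0) + voteCount (g ∘ s) a := by
  simp only [voteCount, Finset.card_filter]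
  rw [Fin.sum_univ_succAbove _ i]
  simp

theorem voteCount_add_le (c : ι → κ) {a b : κ} (hab : a ≠ b) :
    voteCount c a ≤ #{i | c i ≠ b} := by
  refine Finset.card_le_card fun i => ?_
  simp only [Finset.mem_filter, Finset.mem_univ, true_and]
  rintro h rfl
  exact hab h.symm

theorem voteCount_add_card_ne (c : ι → κ) (b : κ) :
    voteCount c b + #{i | c i ≠ b} = Fintype.card ι := by
  rw [voteCount, Finset.card_filter_add_card_filter_not, Finset.card_univ]

/-- In a sample in which `a` is at least as frequent as `b`, half of the entries differ from `b`;
removing one of them at random leaves a near tie. -/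
theorem card_tie_le (g : ι → κ) {a b : κ} (hab : a ≠ b) (N : ℕ) :
    #{s : Fin (N + 1) → ι | voteCount (g ∘ s) b ≤ voteCount (g ∘ s) a} ≤
      2 * (#{k | g k ≠ b} *
        #{s : Fin N → ι | voteCount (g ∘ s) b ≤ voteCount (g ∘ s) a + 1}) := by
  classical
  set A := #{k | g k ≠ b} *
        #{s : Fin N → ι | voteCount (g ∘ s) b ≤ voteCount (g ∘ s) a + 1} with hA
  set B : Finset (Fin (N + 1) → ι) := {s | voteCount (g ∘ s) b ≤ voteCount (g ∘ s) a} with hB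
  -- Deleting an entry different from `b` keeps the votes for `b` and loses at most one for `a`. The
  -- sample is recovered from the deleted entry and the rest.
  have h1 : ∀ i : Fin (N + 1), #{s ∈ B | g (s i) ≠ b} ≤ A := by
    intro i
    rw [hA, ← Finset.card_product]
    refine Finset.card_le_card_of_injOn (fun s => (s i, i.removeNth s)) ?_ ?_
    · intro s hs
      simp only [hB, Finset.coe_filter, Finset.mem_filter, Finset.mem_univ, true_and,
        Set.mem_ofPred_eq] at hs
      simp only [Finset.coe_product, Finset.coe_filter, Finset.mem_univ, true_and, Set.mem_prod,
        Set.mem_ofPred_eq]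
      refine ⟨hs.2, ?_⟩
      have h := hs.1
      rw [← Fin.insertNth_self_removeNth i s, voteCount_insertNth, voteCount_insertNth,
        if_neg hs.2] at h
      split_ifs at h <;> omega
    · intro s _ s' _ h
      simp only [Prod.mk.injEq] at h
      rw [← Fin.insertNth_self_removeNth i s, ← Fin.insertNth_self_removeNth i s', h.1, h.2]
  -- Double counting of pairs of a sample in `B` and a position whose entry differs from `b`: each
  -- sample has at least `(N + 1) / 2` such positions.
  have h2 : #B * (N + 1) ≤ ∑ s ∈ B, 2 * #{i : Fin (N + 1) | g (s i) ≠ b} := by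
    rw [← smul_eq_mul, ← Finset.sum_const]
    refine Finset.sum_le_sum fun s hs => ?_
    have e1 := voteCount_add_card_ne (g ∘ s) b
    have e2 := voteCount_add_le (g ∘ s) hab
    simp only [hB, Finset.mem_filter, Finset.mem_univ, true_and] at hs
    simp only [Function.comp_apply, Fintype.card_fin] at e1 e2
    omega
  have h3 : ∑ s ∈ B, 2 * #{i : Fin (N + 1) | g (s i) ≠ b} = 2 * ∑ i, #{s ∈ B | g (s i) ≠ b} := by
    simp only [Finset.card_filter]
    rw [← Finset.mul_sum, Finset.sum_comm]
  have h4 : ∑ i : Fin (N + 1), #{s ∈ B | g (s i) ≠ b} ≤ (N + 1) * A := by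
    calc _ ≤ ∑ i : Fin (N + 1), A := Finset.sum_le_sum fun i _ => h1 i
      _ = _ := by simp
  have : #B * (N + 1) ≤ (2 * A) * (N + 1) := by
    calc _ ≤ _ := h2
      _ = _ := h3
      _ ≤ 2 * ((N + 1) * A) := by omega
      _ = _ := by ring
  exact Nat.le_of_mul_le_mul_right this (Nat.succ_pos N)

theorem mul_exp_neg_le {x : ℝ} : x * exp (-x) ≤ exp (-1) := by
  have h := add_one_le_exp (x - 1)
  have : exp (-1) = exp (x - 1) * exp (-x) := by rw [← exp_add]; ring_nf
  rw [this]
  gcongr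
  linarith

/-- The numerical inequality behind the approximation ratio. -/
theorem tail_constant_le {N : ℕ} (hN : 2 ≤ N) (δ : ℝ) :
    2 * δ * exp (1 / √N - 1 / √N * N * δ + N * ((1 / √N) ^ 2 / 2)) ≤
      4 / (√(exp 1) * (√(4 * ((N + 1 : ℕ) : ℝ) + 1) - 3)) := by
  have hN' : (2 : ℝ) ≤ N := by exact_mod_cast hN
  set y := √(N : ℝ) with hy
  have hyy : y ^ 2 = N := by rw [hy, sq_sqrt]; positivity
  have hy1 : 1 < y := by
    rw [hy]; apply lt_sqrt_of_sq_lt; linarith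
  have hy0 : 0 < y := by linarith
  set z := √(4 * ((N + 1 : ℕ) : ℝ) + 1) with hz
  have hzz : z ^ 2 = 4 * y ^ 2 + 5 := by
    rw [hz, sq_sqrt (by positivity), hyy]; push_cast; ring
  have hz0 : 0 ≤ z := sqrt_nonneg _
  have hz3 : 3 < z := by nlinarith
  -- With `r = N + 1` this replaces `2 * √N - 2` by the smaller `√(4 * r + 1) - 3` in the final
  -- denominator.
  have hzle : z ≤ 2 * y + 1 := by nlinarith
  have he : √(exp 1) = exp (1 / 2) := by rw [exp_half]
  rw [he]
  have e1 : (1 / y - 1 / y * N * δ + N * ((1 / y) ^ 2 / 2)) = 1 / y + 1 / 2 + -(y * δ) := by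
    rw [← hyy]; field_simp; ring
  rw [e1, exp_add, exp_add]
  -- The only place where `δ` is eliminated: `x * exp (-x)` is largest at `x = 1`.
  have h1 : (y * δ) * exp (-(y * δ)) ≤ exp (-1) := mul_exp_neg_le
  have h2 : exp (1 / y) ≤ y / (y - 1) := by
    have h := add_one_le_exp (-(1 / y))
    have : exp (1 / y) * exp (-(1 / y)) = 1 := by rw [← exp_add]; simp
    rw [le_div_iff₀ (by linarith)]
    have h' : y - 1 ≤ y * exp (-(1 / y)) := by
      have : y * (-(1 / y) + 1) = y - 1 := by field_simp; ring
      nlinarith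
    calc _ ≤ exp (1 / y) * (y * exp (-(1 / y))) := by gcongr
      _ = y * (exp (1 / y) * exp (-(1 / y))) := by ring
      _ = y := by rw [this, mul_one]
  have h3 : exp (1 / 2) * exp (-1) = (exp (1 / 2))⁻¹ := by
    rw [← exp_add, ← exp_neg]; norm_num
  have h4 : 2 * δ * (exp (1 / y) * exp (1 / 2) * exp (-(y * δ))) =
      2 / y * exp (1 / y) * (exp (1 / 2) * ((y * δ) * exp (-(y * δ)))) := by
    field_simp
  rw [h4]
  calc _ ≤ 2 / y * exp (1 / y) * (exp (1 / 2) * exp (-1)) := by gcongr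
    _ ≤ 2 / y * (y / (y - 1)) * (exp (1 / 2) * exp (-1)) := by gcongr
    _ = 2 / (y - 1) * (exp (1 / 2))⁻¹ := by rw [h3]; field_simp
    _ = 4 / (exp (1 / 2) * (2 * y + 1 - 3)) := by
      have : y - 1 ≠ 0 := by linarith
      have : 2 * y + 1 - 3 = 2 * (y - 1) := by ring
      rw [this]; field_simp; norm_num
    _ ≤ 4 / (exp (1 / 2) * (z - 3)) := by
      have : 0 < exp (1 / 2 : ℝ) * (z - 3) := mul_pos (exp_pos _) (by linarith)
      gcongr

/-- `maj` selects a most frequent entry. -/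
def IsMajority {r : ℕ} (maj : (Fin r → κ) → κ) : Prop :=
  ∀ c a, voteCount c a ≤ voteCount c (maj c)

/-- A union bound over the letters that can defeat the most frequent letter `b'`. Each of the `card
κ - 1` other letters costs at most `4 / K` times the optimum of the column, whatever its frequency.
-/
theorem sum_card_ne_majority_le [Nonempty ι] [Fintype κ] (g : ι → κ) {N : ℕ} (hN : 2 ≤ N)
    {maj : (Fin (N + 1) → κ) → κ} (hmaj : IsMajority maj) (b : κ) :
    (∑ s : Fin (N + 1) → ι, (#{i | g i ≠ maj (g ∘ s)} : ℝ)) ≤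
      (1 + (4 * (Fintype.card κ : ℝ) - 4) / (√(exp 1) * (√(4 * ((N + 1 : ℕ) : ℝ) + 1) - 3))) *
        ((Fintype.card ι : ℝ) ^ (N + 1) * #{i | g i ≠ b}) := by
  classical
  set m : ℝ := (Fintype.card ι : ℝ) with hm
  have hm0 : 0 < m := by rw [hm]; exact_mod_cast Fintype.card_pos
  set K := √(exp 1) * (√(4 * ((N + 1 : ℕ) : ℝ) + 1) - 3) with hK
  have hK0 : 0 < K := by
    have hN' : (2 : ℝ) ≤ N := by exact_mod_cast hN
    refine mul_pos (sqrt_pos.2 (exp_pos _)) (sub_pos.2 ?_)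
    apply lt_sqrt_of_sq_lt
    push_cast; linarith
  have hcard : 1 ≤ (Fintype.card κ : ℝ) := by
    have : Nonempty κ := ⟨b⟩
    exact_mod_cast Fintype.card_pos
  have hne : ∀ c : κ, (#{i | g i ≠ c} : ℝ) = m - voteCount g c := by
    intro c
    have := voteCount_add_card_ne g c
    rw [hm, ← this]; push_cast; ring
  obtain ⟨b', -, hb'⟩ := Finset.exists_max_image (univ : Finset κ) (fun c => voteCount g c) ⟨b, mem_univ b⟩
  have hb'' : ∀ c, (voteCount g c : ℝ) ≤ voteCount g b' := fun c => by exact_mod_cast hb' c (mem_univ c)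
  set S : ℝ := (#{i | g i ≠ b'} : ℝ) with hS
  have hSb : S ≤ #{i | g i ≠ b} := by rw [hS, hne, hne]; linarith [hb'' b]
  have hS0 : 0 ≤ S := by rw [hS]; positivity
  -- each other letter contributes at most `4 / K` times the optimum
  have hlet : ∀ a ≠ b', (#{s : Fin (N + 1) → ι | voteCount (g ∘ s) b' ≤ voteCount (g ∘ s) a} : ℝ) *
      ((voteCount g b' : ℝ) - voteCount g a) ≤ 4 / K * (m ^ (N + 1) * S) := by
    intro a ha
    have h1 : (#{s : Fin (N + 1) → ι | voteCount (g ∘ s) b' ≤ voteCount (g ∘ s) a} : ℝ) ≤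
        2 * (S * #{s : Fin N → ι | voteCount (g ∘ s) b' ≤ voteCount (g ∘ s) a + 1}) := by
      rw [hS]; exact_mod_cast card_tie_le g ha N
    -- The choice `t = 1 / √N` makes the quadratic term of the exponent equal to `1 / 2`.
    have h2 := card_near_tie_le g a b' N (1 / √N) (by positivity)
    set δ := ((voteCount g b' : ℝ) - voteCount g a) / Fintype.card ι with hδ
    have hδ' : (voteCount g b' : ℝ) - voteCount g a = m * δ := by rw [hδ, hm]; field_simp
    have hδ0 : 0 ≤ δ := div_nonneg (by linarith [hb'' a]) hm0.le
    have h3 := tail_constant_le hN δ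
    rw [← hK] at h3
    rw [hδ']
    generalize exp (1 / √N - 1 / √N * N * δ + N * ((1 / √N) ^ 2 / 2)) = E at h2 h3
    have h4 := h1.trans (mul_le_mul_of_nonneg_left (mul_le_mul_of_nonneg_left h2 hS0) zero_le_two)
    calc _ ≤ 2 * (S * (m ^ N * E)) * (m * δ) :=
          mul_le_mul_of_nonneg_right h4 (mul_nonneg hm0.le hδ0)
      _ = (2 * δ * E) * (m ^ (N + 1) * S) := by ring
      _ ≤ _ := mul_le_mul_of_nonneg_right h3 (mul_nonneg (pow_nonneg hm0.le _) hS0)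
  -- If the sample elects `a ≠ b'`, the cost exceeds `S` by the difference of the two frequencies,
  -- and the tie event for `a` holds.
  have hpt : ∀ s : Fin (N + 1) → ι, (#{i | g i ≠ maj (g ∘ s)} : ℝ) ≤
      S + ∑ a ∈ univ.erase b', (if voteCount (g ∘ s) b' ≤ voteCount (g ∘ s) a then
        (voteCount g b' : ℝ) - voteCount g a else 0) := by
    intro s
    have hnn : ∀ a ∈ univ.erase b', (0 : ℝ) ≤ (if voteCount (g ∘ s) b' ≤ voteCount (g ∘ s) a then
        (voteCount g b' : ℝ) - voteCount g a else 0) := by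
      intro a _
      split_ifs
      · linarith [hb'' a]
      · exact le_rfl
    by_cases h : maj (g ∘ s) = b'
    · rw [h]
      linarith [Finset.sum_nonneg hnn]
    · have := Finset.single_le_sum hnn (mem_erase.2 ⟨h, mem_univ _⟩)
      rw [if_pos (hmaj _ _)] at this
      rw [hS, hne, hne]
      linarith
  calc _ ≤ ∑ s : Fin (N + 1) → ι, (S + ∑ a ∈ univ.erase b',
        (if voteCount (g ∘ s) b' ≤ voteCount (g ∘ s) a then
        (voteCount g b' : ℝ) - voteCount g a else 0)) := Finset.sum_le_sum fun s _ => hpt s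
    _ = m ^ (N + 1) * S + ∑ a ∈ univ.erase b',
        (#{s : Fin (N + 1) → ι | voteCount (g ∘ s) b' ≤ voteCount (g ∘ s) a} : ℝ) *
      ((voteCount g b' : ℝ) - voteCount g a) := by
        rw [Finset.sum_add_distrib, Finset.sum_comm]
        congr 1
        · simp [hm]
        · refine Finset.sum_congr rfl fun a _ => ?_
          rw [← Finset.sum_filter, Finset.sum_const, nsmul_eq_mul]
    _ ≤ m ^ (N + 1) * S + ∑ a ∈ univ.erase b', 4 / K * (m ^ (N + 1) * S) := by
        refine add_le_add_right (Finset.sum_le_sum fun a ha => ?_) _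
        exact hlet a (ne_of_mem_erase ha)
    _ = (1 + (4 * (Fintype.card κ : ℝ) - 4) / K) * (m ^ (N + 1) * S) := by
        rw [Finset.sum_const, card_erase_of_mem (mem_univ _), card_univ, nsmul_eq_mul,
          Nat.cast_sub (by exact_mod_cast hcard)]
        push_cast; ring
    _ ≤ _ := by
        have : 0 ≤ (4 * (Fintype.card κ : ℝ) - 4) / K := div_nonneg (by linarith) hK0.le
        gcongr

/-! ### Samples that repeat one position, and the existence of a good sample -/

theorem majority_const {r : ℕ} (hr : 0 < r) {maj : (Fin r → κ) → κ} (hmaj : IsMajority maj)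
    (a : κ) : maj (fun _ => a) = a := by
  by_contra h
  have h1 := hmaj (fun _ => a) a
  simp [voteCount, Ne.symm h] at h1
  omega

/-- A random entry `g k` equals `b` except for a `#{g ≠ b} / card ι` fraction of the `k`, and then
the cost is at most `card ι`. The two cases contribute equally. -/
theorem sum_card_ne_le_two_mul (g : ι → κ) (b : κ) :
    ∑ k, #{i | g i ≠ g k} ≤ 2 * (Fintype.card ι * #{i | g i ≠ b}) := by
  have h : ∀ k, #{i | g i ≠ g k} ≤ #{i | g i ≠ b} + if g k ≠ b then Fintype.card ι else 0 := by
    intro k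
    split_ifs with hk
    · exact (Finset.card_le_univ _).trans (Nat.le_add_left _ _)
    · rw [not_not.1 hk, add_zero]
  refine (Finset.sum_le_sum fun k _ => h k).trans ?_
  rw [Finset.sum_add_distrib, ← Finset.sum_filter, Finset.sum_const, Finset.sum_const, card_univ,
    smul_eq_mul, smul_eq_mul]
  apply le_of_eq
  ring

/-- The ratio for samples of size `r`. -/
noncomputable def sampleRatio (σ r : ℕ) : ℝ :=
  min 2 (1 + (4 * (σ : ℝ) - 4) / (√(exp 1) * (√(4 * (r : ℝ) + 1) - 3)))

/-- Averaging the total cost of all columns: over the constant samples for the ratio 2, over all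
samples for the other ratio. -/
theorem exists_sample [Nonempty ι] [Fintype κ] {N : ℕ} (hN : 2 ≤ N)
    {maj : (Fin (N + 1) → κ) → κ} (hmaj : IsMajority maj) {l : ℕ} (v : Fin l → ι → κ)
    (b : Fin l → κ) :
    ∃ s : Fin (N + 1) → ι, ((∑ j, #{i | v j i ≠ maj (v j ∘ s)} : ℕ) : ℝ) ≤
      sampleRatio (Fintype.card κ) (N + 1) * ((∑ j, #{i | v j i ≠ b j} : ℕ) : ℝ) := by
  have hm0 : (0 : ℝ) < Fintype.card ι := by exact_mod_cast Fintype.card_pos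
  rw [sampleRatio]
  rcases min_cases (2 : ℝ) (1 + (4 * (Fintype.card κ : ℝ) - 4) /
      (√(exp 1) * (√(4 * ((N + 1 : ℕ) : ℝ) + 1) - 3))) with ⟨h, -⟩ | ⟨h, -⟩
  · rw [h]
    obtain ⟨k, -, hk⟩ := Finset.exists_le_of_sum_le (s := (univ : Finset ι)) univ_nonempty
      (f := fun k => ((∑ j, #{i | v j i ≠ maj (v j ∘ fun _ => k)} : ℕ) : ℝ))
      (g := fun _ => 2 * ((∑ j, #{i | v j i ≠ b j} : ℕ) : ℝ)) (by
        have h1 : ∀ j k, maj (v j ∘ fun _ => k) = v j k := fun j k =>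
          majority_const (Nat.succ_pos N) hmaj (v j k)
        simp only [h1]
        rw [Finset.sum_const, card_univ, nsmul_eq_mul]
        norm_cast
        rw [Finset.sum_comm]
        refine (Finset.sum_le_sum fun j _ => sum_card_ne_le_two_mul (v j) (b j)).trans ?_
        rw [← Finset.mul_sum, ← Finset.mul_sum]
        apply le_of_eq
        ring)
    exact ⟨_, hk⟩
  · rw [h]
    obtain ⟨s, -, hs⟩ := Finset.exists_le_of_sum_le (s := (univ : Finset (Fin (N + 1) → ι)))
      univ_nonempty
      (f := fun s => ((∑ j, #{i | v j i ≠ maj (v j ∘ s)} : ℕ) : ℝ))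
      (g := fun _ => (1 + (4 * (Fintype.card κ : ℝ) - 4) /
        (√(exp 1) * (√(4 * ((N + 1 : ℕ) : ℝ) + 1) - 3))) *
        ((∑ j, #{i | v j i ≠ b j} : ℕ) : ℝ)) (by
        push_cast
        rw [Finset.sum_comm]
        have := Finset.sum_le_sum fun j (_ : j ∈ univ) =>
          sum_card_ne_majority_le (v j) hN hmaj (b j)
        push_cast at this
        refine this.trans (le_of_eq ?_)
        rw [← Finset.mul_sum, ← Finset.mul_sum, Finset.sum_const, card_univ, nsmul_eq_mul,
          Fintype.card_fun, Fintype.card_fin]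
        push_cast
        ring)
    exact ⟨s, hs⟩

end Sampling

/-- Lets the general facts about `List.count` apply to patterns. -/
instance Sum.lawfulBEq {α β : Type*} [BEq α] [LawfulBEq α] [BEq β] [LawfulBEq β] :
    LawfulBEq (α ⊕ β) where
  eq_of_beq := by
    intro a b h
    rcases a with a | a <;> rcases b with b | b <;> first | exact congrArg _ (eq_of_beq h) | cases h
  rfl := by
    intro a
    rcases a with a | a <;> exact beq_self_eq_true a

/-! ### The Hamming distance of words -/

section Words

variable {σ : ℕ}

theorem wordDist_append {u v : PWord σ} (h : u.length = v.length) (u' v' : PWord σ) :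
    wordDist (u ++ u') (v ++ v') = wordDist u v + wordDist u' v' := by
  rw [wordDist, List.zip_append h, List.countP_append, wordDist, wordDist]

theorem wordDist_self (u : PWord σ) : wordDist u u = 0 := by
  induction u with
  | nil => rfl
  | cons a u ih => simpa [wordDist] using ih

theorem wordDist_singleton (a b : Fin σ) : wordDist [a] [b] = if a = b then 0 else 1 := by
  by_cases h : a = b <;> simp [wordDist, h]

theorem wordDist_le_length (u v : PWord σ) : wordDist u v ≤ v.length := by
  refine List.countP_le_length.trans ?_
  simp

theorem wordDist_eq_sum {u v : PWord σ} {l : ℕ} (hu : u.length = l) (hv : v.length = l) :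
    wordDist u v = ∑ j : Fin l, if u[j] = v[j] then 0 else 1 := by
  induction l generalizing u v with
  | zero =>
    rw [List.length_eq_zero_iff] at hu hv
    subst hu hv
    rfl
  | succ l ih =>
    obtain ⟨a, u, rfl⟩ := List.exists_cons_of_length_eq_add_one hu
    obtain ⟨b, v, rfl⟩ := List.exists_cons_of_length_eq_add_one hv
    have h : wordDist (a :: u) (b :: v) = wordDist [a] [b] + wordDist u v :=
      wordDist_append (u := [a]) (v := [b]) rfl u v
    rw [Fin.sum_univ_succ, h, wordDist_singleton, ih (by simpa using hu) (by simpa using hv)]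
    rfl

theorem subst_append (h : ℕ → PWord σ) (α β : Pattern σ) :
    Pattern.subst h (α ++ β) = Pattern.subst h α ++ Pattern.subst h β := by
  simp [Pattern.subst]

theorem subst_inl (h : ℕ → PWord σ) (a : Fin σ) : Pattern.subst h [Sum.inl a] = [a] := by
  simp [Pattern.subst]

theorem subst_inr (h : ℕ → PWord σ) (x : ℕ) : Pattern.subst h [Sum.inr x] = h x := by
  simp [Pattern.subst]

theorem subst_update_of_notMem (h : ℕ → PWord σ) {α : Pattern σ} {x : ℕ} (hx : Sum.inr x ∉ α)
    (u : PWord σ) : Pattern.subst (Function.update h x u) α = Pattern.subst h α := by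
  induction α with
  | nil => rfl
  | cons c α ih =>
    simp only [List.mem_cons, not_or] at hx
    rw [← List.singleton_append, subst_append, subst_append, ih hx.2]
    congr 1
    rcases c with a | y
    · rw [subst_inl, subst_inl]
    · rw [subst_inr, subst_inr, Function.update_of_ne]
      rintro rfl
      exact hx.1 rfl

/-- The distance between an image of `α` and `w` as a function of the value of one variable: it is
the sum of the distances at the occurrences of that variable and of a constant. -/
theorem exists_occurrences (h : ℕ → PWord σ) (x : ℕ) (α : Pattern σ) (w : PWord σ)
    (hw : (α.subst h).length = w.length) :
    ∃ (d : ℕ) (L : List ℕ), (∀ p ∈ L, p + (h x).length ≤ w.length) ∧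
      L.length = α.count (Sum.inr x) ∧ L.length * (h x).length ≤ w.length ∧
      ∀ u : PWord σ, u.length = (h x).length →
        (α.subst (Function.update h x u)).length = w.length ∧
        wordDist (α.subst (Function.update h x u)) w =
          d + (L.map fun p => wordDist u ((w.drop p).take (h x).length)).sum := by
  induction α generalizing w with
  | nil =>
    refine ⟨0, [], by simp, rfl, by simp, fun u _ => ⟨hw, ?_⟩⟩
    have : w = [] := by
      rw [← List.length_eq_zero_iff, ← hw]; rfl
    subst this
    rfl
  | cons c α ih =>
    rw [← List.singleton_append, subst_append, List.length_append] at hw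
    set k := (Pattern.subst h [c]).length with hk
    obtain ⟨d, L, hL1, hL2, hL3, hL4⟩ := ih (w.drop k) (by rw [List.length_drop]; omega)
    have hsplit : w = w.take k ++ w.drop k := (List.take_append_drop k w).symm
    have htk : (w.take k).length = k := by rw [List.length_take]; omega
    -- Positions found in the rest of `w` are shifted by the length `k` of the image of the first
    -- symbol.
    have hmap : ∀ u : PWord σ, ((L.map (k + ·)).map fun p =>
        wordDist u ((w.drop p).take (h x).length)) =
        L.map fun p => wordDist u (((w.drop k).drop p).take (h x).length) := by
      intro u
      rw [List.map_map]
      refine List.map_congr_left fun p _ => ?_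
      simp [List.drop_drop]
    rw [List.length_drop] at hL1 hL3 hL4
    by_cases hc : c = Sum.inr x
    · subst hc
      rw [subst_inr] at hk
      refine ⟨d, 0 :: L.map (k + ·), ?_, ?_, ?_, fun u hu => ?_⟩
      · intro p hp
        rcases List.mem_cons.1 hp with rfl | hp
        · omega
        · obtain ⟨q, hq, rfl⟩ := List.mem_map.1 hp
          have := hL1 q hq
          show k + q + _ ≤ _
          omega
      · simp [hL2]
      · rw [List.length_cons, List.length_map, Nat.succ_mul]; omega
      · obtain ⟨h1, h2⟩ := hL4 u hu
        rw [← List.singleton_append, subst_append, subst_inr, Function.update_self]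
        refine ⟨by rw [List.length_append]; omega, ?_⟩
        conv_lhs => rw [hsplit]
        rw [wordDist_append (by omega), h2, List.map_cons, hmap, List.sum_cons, List.drop_zero, ← hk]
        omega
    · have hsub : ∀ u, Pattern.subst (Function.update h x u) [c] = Pattern.subst h [c] := fun u =>
        subst_update_of_notMem h (by simpa using Ne.symm hc) u
      refine ⟨wordDist (Pattern.subst h [c]) (w.take k) + d, L.map (k + ·), ?_, ?_, ?_,
        fun u hu => ?_⟩
      · intro p hp
        obtain ⟨q, hq, rfl⟩ := List.mem_map.1 hp
        have := hL1 q hq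
        show k + q + _ ≤ _
        omega
      · rw [List.length_map, List.count_cons_of_ne hc, hL2]
      · rw [List.length_map]; omega
      · obtain ⟨h1, h2⟩ := hL4 u hu
        rw [← List.singleton_append, subst_append, hsub]
        refine ⟨by rw [List.length_append]; omega, ?_⟩
        conv_lhs => rw [hsplit]
        rw [wordDist_append (by omega), h2, hmap]
        omega

end Words

/-! ### Dynamic programming over a regular pattern

A row assigns to `j ≤ n` the least distance between the length-`j` prefix of `w` and a word of a
language that has length `j`, where `n + 1` stands for `∞`. Symbols are given by their codes: those
of the word are `inp 0, …, inp (n - 1)`, and those of the pattern are `inp n, inp (n + 1), …`. -/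

/-- The row of the empty word. -/
def initRow (n j : ℕ) : ℕ := if j = 0 then 0 else n + 1

/-- Appending the letter with code `c`. -/
def letterRow (n : ℕ) (inp : ℕ → ℕ) (c : ℕ) (row : ℕ → ℕ) : ℕ → ℕ
  | 0 => n + 1
  | j + 1 => if inp j = c then row j else if row j < n + 1 then row j + 1 else row j

/-- Appending an arbitrary word. -/
def varRow (row : ℕ → ℕ) : ℕ → ℕ
  | 0 => row 0
  | j + 1 => min (row (j + 1)) (varRow row j)

/-- Appending the letters with codes `u 0, …, u (l - 1)`. -/
def wordRow (n : ℕ) (inp u : ℕ → ℕ) (row : ℕ → ℕ) : ℕ → ℕ → ℕ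
  | 0 => row
  | l + 1 => letterRow n inp (u l) (wordRow n inp u row l)

/-- Appending the pattern symbol with code `c`, where the variable with code `x` has the value
`u 0, …, u (l - 1)`. -/
def symbolRow (σ n : ℕ) (inp : ℕ → ℕ) (x l : ℕ) (u : ℕ → ℕ) (c : ℕ) (row : ℕ → ℕ) : ℕ → ℕ :=
  if σ < c then if c = x then wordRow n inp u row l else varRow row else letterRow n inp c row

/-- The row of the first `i` symbols of the pattern. -/
def patternRow (σ n : ℕ) (inp : ℕ → ℕ) (x l : ℕ) (u : ℕ → ℕ) : ℕ → ℕ → ℕ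
  | 0 => initRow n
  | i + 1 => symbolRow σ n inp x l u (inp (n + i)) (patternRow σ n inp x l u i)

/-- The row gives the distances to the words of `S`. -/
structure IsRowOf {σ : ℕ} (w : PWord σ) (row : ℕ → ℕ) (S : Set (PWord σ)) : Prop where
  le_dist : ∀ v ∈ S, v.length ≤ w.length → row v.length ≤ wordDist v (w.take v.length)
  attained : ∀ j ≤ w.length, row j ≤ w.length →
    ∃ v ∈ S, v.length = j ∧ wordDist v (w.take j) = row j

section Rows

variable {σ : ℕ} {w : PWord σ} {row : ℕ → ℕ} {S : Set (PWord σ)} {inp : ℕ → ℕ}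

theorem isRowOf_init : IsRowOf w (initRow w.length) {[]} where
  le_dist := by
    rintro v rfl -
    simp [initRow]
  attained := by
    intro j hj h
    rw [initRow] at h
    split_ifs at h with h0
    · subst h0
      exact ⟨[], rfl, rfl, by simp [initRow, wordDist]⟩
    · omega

theorem IsRowOf.letter (h : IsRowOf w row S)
    (hinp : ∀ j (hj : j < w.length), inp j = symCode (Sum.inl w[j])) (a : Fin σ) :
    IsRowOf w (letterRow w.length inp (symCode (Sum.inl a)) row) {v | ∃ v' ∈ S, v = v' ++ [a]} := by
  have hcode : ∀ j (hj : j < w.length), inp j = symCode (Sum.inl a) ↔ a = w[j] := by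
    intro j hj
    rw [hinp j hj, symCode, symCode, Fin.ext_iff]
    omega
  have hdist : ∀ (v : PWord σ) (hv : v.length < w.length),
      wordDist (v ++ [a]) (w.take (v.length + 1)) =
        wordDist v (w.take v.length) + if a = w[v.length] then 0 else 1 := by
    intro v hv
    rw [List.take_succ_eq_append_getElem hv, wordDist_append (by rw [List.length_take]; omega),
      wordDist_singleton]
  constructor
  · rintro _ ⟨v, hv, rfl⟩ hl
    rw [List.length_append, List.length_singleton] at hl ⊢
    have := h.le_dist v hv (by omega)
    rw [hdist v hl, letterRow]
    simp only [hcode _ hl]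
    split_ifs <;> omega
  · intro j hj hr
    cases j with
    | zero => rw [letterRow] at hr; omega
    | succ j =>
      have hrj : row j ≤ w.length := by
        rw [letterRow] at hr
        split_ifs at hr <;> omega
      obtain ⟨v, hv, rfl, hd⟩ := h.attained j (by omega) hrj
      refine ⟨v ++ [a], ⟨v, hv, rfl⟩, by simp, ?_⟩
      rw [hdist v hj, letterRow, hd]
      simp only [hcode _ hj]
      split_ifs <;> omega

theorem IsRowOf.word {x : ℕ → ℕ} (h : IsRowOf w row S)
    (hinp : ∀ j (hj : j < w.length), inp j = symCode (Sum.inl w[j])) (u : PWord σ)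
    (hu : ∀ j (hj : j < u.length), x j = symCode (Sum.inl u[j])) :
    IsRowOf w (wordRow w.length inp x row u.length) {v | ∃ v' ∈ S, v = v' ++ u} := by
  induction u using List.reverseRecOn with
  | nil => simpa [wordRow] using h
  | append_singleton u a ih =>
    have ih' := (ih fun j hj => by
      rw [hu j (by rw [List.length_append]; omega), List.getElem_append_left hj]).letter hinp a
    have hx : x u.length = symCode (Sum.inl a) := by
      rw [hu u.length (by simp)]; simp
    rw [List.length_append, List.length_singleton, wordRow, hx]
    convert ih' using 1
    ext v
    constructor
    · rintro ⟨v', hv', rfl⟩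
      exact ⟨v' ++ u, ⟨v', hv', rfl⟩, by simp⟩
    · rintro ⟨_, ⟨v', hv', rfl⟩, rfl⟩
      exact ⟨v', hv', by simp⟩

theorem varRow_le (row : ℕ → ℕ) {i j : ℕ} (hij : i ≤ j) : varRow row j ≤ row i := by
  induction j with
  | zero => rw [Nat.le_zero.1 hij, varRow]
  | succ j ih =>
    rw [varRow]
    rcases Nat.le_succ_iff.1 hij with h | rfl
    · exact (min_le_right _ _).trans (ih h)
    · exact min_le_left _ _

theorem exists_varRow_eq (row : ℕ → ℕ) (j : ℕ) : ∃ i ≤ j, varRow row j = row i := by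
  induction j with
  | zero => exact ⟨0, le_rfl, rfl⟩
  | succ j ih =>
    obtain ⟨i, hi, h⟩ := ih
    rw [varRow]
    rcases min_choice (row (j + 1)) (varRow row j) with h' | h'
    · exact ⟨j + 1, le_rfl, h'⟩
    · exact ⟨i, by omega, h'.trans h⟩

/-- A free variable can copy the factor it faces at no cost, so the best prefix length `i ≤ j`
decides. -/
theorem IsRowOf.var (h : IsRowOf w row S) :
    IsRowOf w (varRow row) {v | ∃ v' ∈ S, ∃ z, v = v' ++ z} := by
  have hdist : ∀ v z : PWord σ, v.length + z.length ≤ w.length →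
      wordDist (v ++ z) (w.take (v.length + z.length)) =
        wordDist v (w.take v.length) + wordDist z ((w.drop v.length).take z.length) := by
    intro v z hl
    rw [List.take_add, wordDist_append (by rw [List.length_take]; omega)]
  constructor
  · rintro _ ⟨v, hv, z, rfl⟩ hl
    rw [List.length_append] at hl ⊢
    rw [hdist v z hl]
    have h1 := varRow_le row (Nat.le_add_right v.length z.length)
    have h2 := h.le_dist v hv (by omega)
    omega
  · intro j hj hr
    obtain ⟨i, hij, hi⟩ := exists_varRow_eq row j
    rw [hi] at hr ⊢
    obtain ⟨v, hv, rfl, hd⟩ := h.attained i (by omega) hr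
    set z := (w.drop v.length).take (j - v.length) with hz
    have hzl : z.length = j - v.length := by
      rw [hz, List.length_take, List.length_drop]; omega
    have hj' : j = v.length + z.length := by omega
    refine ⟨v ++ z, ⟨v, hv, z, rfl⟩, by rw [List.length_append]; omega, ?_⟩
    rw [hj', hdist v z (by omega), hzl, ← hz, wordDist_self, hd, add_zero]

/-- The images of `α` under the substitutions with value `u` at `x`. -/
def images (x : ℕ) (u : PWord σ) (α : Pattern σ) : Set (PWord σ) :=
  {v | ∃ h : ℕ → PWord σ, h x = u ∧ α.subst h = v}

/-- Induction on the pattern from the right. A variable other than `x` is new when it is met, so its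
value is independent of the prefix already treated. -/
theorem isRowOf_patternRow {α : Pattern σ} {x : ℕ} {u : PWord σ} {uc : ℕ → ℕ}
    (hinp : ∀ j (hj : j < w.length), inp j = symCode (Sum.inl w[j]))
    (hα : ∀ j (hj : j < α.length), inp (w.length + j) = symCode α[j])
    (hu : ∀ j (hj : j < u.length), uc j = symCode (Sum.inl u[j]))
    (hx : ∀ y, y ≠ x → α.count (Sum.inr y) ≤ 1) :
    IsRowOf w (patternRow σ w.length inp (symCode (σ := σ) (Sum.inr x)) u.length uc α.length)
      (images x u α) := by
  induction α using List.reverseRecOn with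
  | nil =>
    have : images x u [] = {[]} := by
      ext v
      constructor
      · rintro ⟨h, -, rfl⟩; rfl
      · rintro rfl; exact ⟨fun _ => u, rfl, rfl⟩
    rw [this]
    exact isRowOf_init
  | append_singleton α c ih =>
    have ih' := ih (fun j hj => by
      rw [hα j (by rw [List.length_append]; omega), List.getElem_append_left hj])
      (fun y hy => (by simp : List.count _ α ≤ _).trans (hx y hy))
    have hc : inp (w.length + α.length) = symCode c := by
      rw [hα α.length (by simp)]; simp
    rw [List.length_append, List.length_singleton, patternRow, hc, symbolRow]
    rcases c with a | y
    · rw [if_neg (by rw [symCode]; omega)]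
      convert ih'.letter hinp a using 1
      ext v
      constructor
      · rintro ⟨h, hu, rfl⟩
        exact ⟨_, ⟨h, hu, rfl⟩, by rw [subst_append, subst_inl]⟩
      · rintro ⟨_, ⟨h, hu, rfl⟩, rfl⟩
        exact ⟨h, hu, by rw [subst_append, subst_inl]⟩
    · rw [if_pos (by rw [symCode]; omega)]
      by_cases hy : y = x
      · subst hy
        rw [if_pos rfl]
        convert ih'.word hinp u hu using 1
        ext v
        constructor
        · rintro ⟨h, hu, rfl⟩
          exact ⟨_, ⟨h, hu, rfl⟩, by rw [subst_append, subst_inr, hu]⟩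
        · rintro ⟨_, ⟨h, hu, rfl⟩, rfl⟩
          exact ⟨h, hu, by rw [subst_append, subst_inr, hu]⟩
      · rw [if_neg (by rw [symCode, symCode]; omega)]
        convert ih'.var using 1
        have hyα : Sum.inr y ∉ α := by
          have := hx y hy
          rw [List.count_append, List.count_singleton_self] at this
          rw [← List.count_eq_zero]
          omega
        ext v
        constructor
        · rintro ⟨h, hu, rfl⟩
          exact ⟨_, ⟨h, hu, rfl⟩, h y, by rw [subst_append, subst_inr]⟩
        · rintro ⟨_, ⟨h, hu, rfl⟩, z, rfl⟩
          -- Changing the substitution at `y` affects neither the value at `x` nor the image of the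
          -- prefix.
          refine ⟨Function.update h y z, by rw [Function.update_of_ne (Ne.symm hy), hu], ?_⟩
          rw [subst_append, subst_inr, Function.update_self, subst_update_of_notMem h hyα]

theorem letterRow_le {n c : ℕ} (h : ∀ j, row j ≤ n + 1) (j : ℕ) :
    letterRow n inp c row j ≤ n + 1 := by
  cases j with
  | zero => rfl
  | succ j =>
    have := h j
    rw [letterRow]
    split_ifs <;> omega

theorem wordRow_le {n : ℕ} {u : ℕ → ℕ} (h : ∀ j, row j ≤ n + 1) (l j : ℕ) :
    wordRow n inp u row l j ≤ n + 1 := by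
  induction l generalizing j with
  | zero => exact h j
  | succ l ih => exact letterRow_le ih j

theorem patternRow_le (σ n x l : ℕ) (u : ℕ → ℕ) (i j : ℕ) :
    patternRow σ n inp x l u i j ≤ n + 1 := by
  induction i generalizing j with
  | zero =>
    rw [patternRow, initRow]
    split_ifs <;> omega
  | succ i ih =>
    rw [patternRow, symbolRow]
    split_ifs
    · exact wordRow_le ih l j
    · exact (varRow_le _ le_rfl).trans (ih j)
    · exact letterRow_le ih j

end Rows

/-! ### The candidates for the value of the repeated variable -/

/-- The first `a` in `1, …, k` with the largest positive number `f a` of votes, and that number;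
it is `(1, 0)` if there are no votes. -/
def argmaxVotes (f : ℕ → ℕ) : ℕ → ℕ × ℕ
  | 0 => (1, 0)
  | a + 1 => if (argmaxVotes f a).2 < f (a + 1) then (a + 1, f (a + 1)) else argmaxVotes f a

theorem argmaxVotes_spec (f : ℕ → ℕ) (k : ℕ) :
    (1 ≤ (argmaxVotes f k).1 ∧ (argmaxVotes f k).1 ≤ max 1 k) ∧
      (argmaxVotes f k).2 ≤ f (argmaxVotes f k).1 ∧
      ∀ a, 1 ≤ a → a ≤ k → f a ≤ (argmaxVotes f k).2 := by
  induction k with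
  | zero => simp [argmaxVotes]; omega
  | succ k ih =>
    obtain ⟨⟨h1, h2⟩, h3, h4⟩ := ih
    rw [argmaxVotes]
    split_ifs with h
    · refine ⟨⟨by simp, by simp⟩, le_rfl, fun a ha hak => ?_⟩
      rcases Nat.le_succ_iff.1 hak with h' | rfl
      · exact (h4 a ha h').trans h.le
      · exact le_rfl
    · refine ⟨⟨h1, by omega⟩, h3, fun a ha hak => ?_⟩
      rcases Nat.le_succ_iff.1 hak with h' | rfl
      · exact h4 a ha h'
      · exact not_lt.1 h

/-- The `i`-th sampled position that is encoded by `T`. -/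
def samplePos (n T i : ℕ) : ℕ := T / (n + 1) ^ (i + 1) % (n + 1)

/-- The number of votes for the letter with code `a` at offset `j`. -/
def codeVotes (n r : ℕ) (inp : ℕ → ℕ) (T j a : ℕ) : ℕ :=
  Nat.count (fun i => inp (samplePos n T i + j) = a) r

/-- The majority letter at offset `j`. -/
def majorityCode (σ n r : ℕ) (inp : ℕ → ℕ) (T j : ℕ) : ℕ :=
  (argmaxVotes (codeVotes n r inp T j) σ).1

/-- The least distance for a pattern with `k` symbols if the variable with code `x` has the value
encoded by `T`. -/
def candidateDist (σ n r : ℕ) (inp : ℕ → ℕ) (k x T : ℕ) : ℕ :=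
  patternRow σ n inp x (T % (n + 1)) (majorityCode σ n r inp T) k n

/-- The least candidate distance; `m` is the number of occurrences of the variable. -/
def bestDist (σ n r : ℕ) (inp : ℕ → ℕ) (k x m : ℕ) : ℕ → ℕ
  | 0 => n + 1
  | T + 1 =>
    if T % (n + 1) * m < n + 1 then
      min (candidateDist σ n r inp k x T) (bestDist σ n r inp k x m T)
    else bestDist σ n r inp k x m T

section Best

variable {σ n r : ℕ} {inp : ℕ → ℕ} {k x m : ℕ}

theorem bestDist_le {T M : ℕ} (hT : T < M) (hm : T % (n + 1) * m < n + 1) :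
    bestDist σ n r inp k x m M ≤ candidateDist σ n r inp k x T := by
  induction M with
  | zero => omega
  | succ M ih =>
    rw [bestDist]
    rcases Nat.lt_succ_iff_lt_or_eq.1 hT with h | rfl
    · have := ih h
      split_ifs
      · exact (min_le_right _ _).trans this
      · exact this
    · rw [if_pos hm]
      exact min_le_left _ _

theorem exists_bestDist_eq {M : ℕ} (h : bestDist σ n r inp k x m M ≤ n) :
    ∃ T, bestDist σ n r inp k x m M = candidateDist σ n r inp k x T := by
  induction M with
  | zero => rw [bestDist] at h; omega
  | succ M ih =>
    rw [bestDist] at h ⊢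
    split_ifs at h ⊢ with hm
    · rcases min_choice (candidateDist σ n r inp k x M) (bestDist σ n r inp k x m M) with h' | h'
      · exact ⟨M, h'⟩
      · rw [h'] at h ⊢
        exact ih h
    · exact ih h

end Best

/-- Every choice of a length and `r` positions is encoded by some candidate number. -/
theorem exists_digits (b r : ℕ) (d : ℕ → ℕ) (hd : ∀ i, d i < b) :
    ∃ T < b ^ r, ∀ i < r, T / b ^ i % b = d i := by
  induction r generalizing d with
  | zero => exact ⟨0, by simp, by simp⟩
  | succ r ih =>
    obtain ⟨T, hT, h⟩ := ih (fun i => d (i + 1)) fun i => hd _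
    have hb : 0 < b := (Nat.zero_le _).trans_lt (hd 0)
    refine ⟨d 0 + b * T, ?_, fun i hi => ?_⟩
    · have := hd 0
      rw [pow_succ]
      nlinarith
    · cases i with
      | zero => rw [pow_zero, Nat.div_one, Nat.add_mul_mod_self_left, Nat.mod_eq_of_lt (hd 0)]
      | succ i =>
        rw [pow_succ', ← Nat.div_div_eq_div_mul, Nat.add_mul_div_left _ _ hb,
          Nat.div_eq_of_lt (hd 0), zero_add]
        exact h i (by omega)

/-! ### The approximation ratio of the best candidate -/

section Approximation

variable {σ : ℕ}

/-- Some `T` encode positions for which the vote reads symbols of the pattern. Since only the codes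
`1, …, σ` are eligible and `1` is the default, the outcome is a word nevertheless, so each candidate
is an admissible value. -/
theorem exists_majorityWord (hσ : 0 < σ) (n r : ℕ) (inp : ℕ → ℕ) (T l : ℕ) :
    ∃ u : PWord σ, u.length = l ∧ ∀ j (hj : j < u.length),
      majorityCode σ n r inp T j = symCode (Sum.inl u[j]) := by
  have h : ∀ j, 1 ≤ majorityCode σ n r inp T j ∧ majorityCode σ n r inp T j ≤ σ := by
    intro j
    have := (argmaxVotes_spec (codeVotes n r inp T j) σ).1
    rw [max_eq_right hσ] at this
    exact this
  refine ⟨List.ofFn fun j : Fin l => ⟨majorityCode σ n r inp T j - 1, ?_⟩, by simp, ?_⟩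
  · have := h j
    omega
  · intro j hj
    have := h j
    simp only [List.getElem_ofFn, symCode]
    omega

/-- The majority letter of a tuple of letters. -/
def majorityLetter (hσ : 0 < σ) {r : ℕ} (c : Fin r → Fin σ) : Fin σ :=
  ⟨(argmaxVotes (fun a => voteCount (fun i => (c i).val + 1) a) σ).1 - 1, by
    have := (argmaxVotes_spec (fun a => voteCount (fun i => (c i).val + 1) a) σ).1
    omega⟩

theorem voteCount_val_succ {r : ℕ} (c : Fin r → Fin σ) (a : Fin σ) :
    voteCount (fun i => (c i).val + 1) (a.val + 1) = voteCount c a := by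
  simp only [voteCount, Nat.succ_inj, Fin.val_inj]

theorem isMajority_majorityLetter (hσ : 0 < σ) {r : ℕ} :
    IsMajority (majorityLetter hσ : (Fin r → Fin σ) → Fin σ) := by
  intro c a
  obtain ⟨h1, h2, h3⟩ := argmaxVotes_spec (fun a => voteCount (fun i => (c i).val + 1) a) σ
  rw [← voteCount_val_succ, ← voteCount_val_succ]
  refine (h3 _ (by omega) a.isLt).trans (h2.trans (le_of_eq ?_))
  congr 1
  simp only [majorityLetter]
  omega

theorem majorityCode_eq (hσ : 0 < σ) {n r : ℕ} {inp : ℕ → ℕ} {T j : ℕ} {c : Fin r → Fin σ}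
    (h : ∀ i : Fin r, inp (samplePos n T i + j) = (c i).val + 1) :
    majorityCode σ n r inp T j = (majorityLetter hσ c).val + 1 := by
  have hv : codeVotes n r inp T j = fun a => voteCount (fun i => (c i).val + 1) a := by
    funext a
    rw [codeVotes, Nat.count_eq_card_filter_range, voteCount, Finset.card_filter,
      Finset.card_filter, Finset.sum_range]
    simp only [h]
  have := (argmaxVotes_spec (fun a => voteCount (fun i => (c i).val + 1) a) σ).1.1
  rw [majorityCode, hv, majorityLetter]
  dsimp only at this ⊢
  omega

theorem dist_getElem_sum {u w : PWord σ} {l p : ℕ} (hu : u.length = l) (hp : p + l ≤ w.length) :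
    wordDist u ((w.drop p).take l) =
      ∑ j : Fin l, if w[p + j.val] = u[j] then 0 else 1 := by
  rw [wordDist_eq_sum hu (by rw [List.length_take, List.length_drop]; omega)]
  refine Finset.sum_congr rfl fun j _ => ?_
  simp only [Fin.getElem_fin, List.getElem_take, List.getElem_drop, eq_comm]

variable {α : Pattern σ} {w : PWord σ} {inp : ℕ → ℕ}

theorem one_le_sampleRatio (hσ : 0 < σ) {r : ℕ} (hr : 3 ≤ r) : 1 ≤ sampleRatio σ r := by
  have hσ' : (1 : ℝ) ≤ σ := by exact_mod_cast hσ
  have hr' : (3 : ℝ) ≤ r := by exact_mod_cast hr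
  have h3 : 3 < √(4 * (r : ℝ) + 1) := Real.lt_sqrt_of_sq_lt (by linarith)
  rw [sampleRatio, le_min_iff]
  refine ⟨by norm_num, ?_⟩
  rw [le_add_iff_nonneg_right]
  exact div_nonneg (by linarith) (mul_nonneg (Real.sqrt_nonneg _) (by linarith))

/-- Replace the value of `x` in the given substitution by the majority word of a good sample of its
occurrences. The positions and all other values stay as they are, so only the cost at the
occurrences changes. The dynamic program does at least as well as this substitution. -/
theorem exists_candidate (hσ : 0 < σ) {r : ℕ} (hr : 3 ≤ r)
    (hinp : ∀ j (hj : j < w.length), inp j = symCode (Sum.inl w[j]))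
    (hα : ∀ j (hj : j < α.length), inp (w.length + j) = symCode α[j]) {x : ℕ}
    (hx : ∀ y, y ≠ x → α.count (Sum.inr y) ≤ 1) (h : ℕ → PWord σ)
    (hw : (α.subst h).length = w.length) :
    ∃ T < (w.length + 1) ^ (r + 1), T % (w.length + 1) * α.count (Sum.inr x) < w.length + 1 ∧
      candidateDist σ w.length r inp α.length (symCode (σ := σ) (Sum.inr x)) T ≤ w.length ∧
      (candidateDist σ w.length r inp α.length (symCode (σ := σ) (Sum.inr x)) T : ℝ) ≤
        sampleRatio σ r * wordDist (α.subst h) w := by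
  set n := w.length with hn
  -- a variable that does not occur may be given the empty value
  have key : ∀ h : ℕ → PWord σ, (α.subst h).length = n → (h x).length ≤ n →
    ∃ T < (n + 1) ^ (r + 1), T % (n + 1) * α.count (Sum.inr x) < n + 1 ∧
      candidateDist σ n r inp α.length (symCode (σ := σ) (Sum.inr x)) T ≤ n ∧
      (candidateDist σ n r inp α.length (symCode (σ := σ) (Sum.inr x)) T : ℝ) ≤
        sampleRatio σ r * wordDist (α.subst h) w := by
    intro h hw hl
    obtain ⟨d, L, hL1, hL2, hL3, hL4⟩ := exists_occurrences h x α w hw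
    set l := (h x).length with hld
    set v : Fin l → Fin L.length → Fin σ := fun j i =>
      w[L[i] + j.val]'(by have := hL1 L[i] (List.getElem_mem _); omega) with hv
    have hsum : ∀ u : PWord σ, ∀ hu : u.length = l,
        (L.map fun p => wordDist u ((w.drop p).take l)).sum =
          ∑ j, (Finset.univ.filter fun i => v j i ≠ u[j]).card := by
      intro u hu
      have h1 : (L.map fun p => wordDist u ((w.drop p).take l)) =
          List.ofFn fun i : Fin L.length => wordDist u ((w.drop L[i]).take l) := by
        apply List.ext_getElem <;> simp
      rw [h1, List.sum_ofFn]
      simp only [Finset.card_filter]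
      rw [Finset.sum_comm]
      refine Finset.sum_congr rfl fun i _ => ?_
      rw [dist_getElem_sum hu (hL1 L[i] (List.getElem_mem _))]
      refine Finset.sum_congr rfl fun j _ => ?_
      simp only [hv, ite_not]
    -- the sampled value
    have hsample : ∃ d : ℕ → ℕ, (∀ i, d i ≤ n) ∧ ∀ T, (∀ i < r, samplePos n T i = d i) →
        ∀ u : PWord σ, ∀ hu : u.length = l, (∀ j (hj : j < u.length),
          majorityCode σ n r inp T j = symCode (Sum.inl u[j])) →
        ((L.map fun p => wordDist u ((w.drop p).take l)).sum : ℝ) ≤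
          sampleRatio σ r * ((L.map fun p => wordDist (h x) ((w.drop p).take l)).sum : ℕ) := by
      rcases Nat.eq_zero_or_pos L.length with h0 | h0
      · refine ⟨fun _ => 0, fun _ => Nat.zero_le _, fun T _ u hu _ => ?_⟩
        rw [List.length_eq_zero_iff.1 h0]
        simp
      · have : Nonempty (Fin L.length) := ⟨⟨0, h0⟩⟩
        obtain ⟨N, rfl⟩ : ∃ N, r = N + 1 := ⟨r - 1, by omega⟩
        obtain ⟨s, hs⟩ := exists_sample (by omega : 2 ≤ N)
          (isMajority_majorityLetter hσ (r := N + 1)) v (fun j => (h x)[j])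
        rw [Fintype.card_fin] at hs
        refine ⟨fun i => if hi : i < N + 1 then L[s ⟨i, hi⟩] else 0, fun i => ?_,
          fun T hT u hu hmaj => ?_⟩
        · dsimp only
          split_ifs with hi
          · have := hL1 L[s ⟨i, hi⟩] (List.getElem_mem _)
            omega
          · omega
        · rw [hsum u hu, hsum (h x) rfl]
          refine le_of_eq_of_le ?_ hs
          have hj : ∀ j : Fin l, u[j] = majorityLetter hσ (v j ∘ s) := by
            intro j
            have h1 := hmaj j (by omega)
            rw [majorityCode_eq hσ (c := v j ∘ s) (fun i => by
              rw [hT i i.isLt]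
              dsimp only
              rw [dif_pos i.isLt, hinp]
              rfl), symCode] at h1
            exact Fin.ext (Nat.succ_inj.1 h1.symm)
          simp only [hj]
    obtain ⟨p, hp, hp'⟩ := hsample
    -- The lowest digit is the length, and the `i`-th sampled position is digit `i + 1`.
    obtain ⟨T, hT, hTd⟩ := exists_digits (n + 1) (r + 1) (fun i => if i = 0 then l else p (i - 1))
      (fun i => by have := hp (i - 1); split_ifs <;> omega)
    have hTl : T % (n + 1) = l := by simpa using hTd 0 (Nat.succ_pos r)
    obtain ⟨u, hu, hmaj⟩ := exists_majorityWord hσ n r inp T l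
    have hd := hp' T (fun i hi => by simpa [samplePos] using hTd (i + 1) (by omega)) u hu hmaj
    refine ⟨T, hT, by rw [hTl, ← hL2, mul_comm]; omega, ?_⟩
    have hrow := isRowOf_patternRow (u := u) hinp hα hmaj hx
    obtain ⟨h1, h2⟩ := hL4 u hu
    obtain ⟨-, h3⟩ := hL4 (h x) rfl
    rw [Function.update_eq_self] at h3
    have h4 := hrow.le_dist _ ⟨Function.update h x u, Function.update_self .., rfl⟩ h1.le
    rw [h1, List.take_length, h2, hu] at h4
    rw [candidateDist, hTl, h3]
    refine ⟨?_, ?_⟩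
    · have := wordDist_le_length (α.subst (Function.update h x u)) w
      rw [h2, hu] at *
      exact h4.trans this
    -- The cost `d` away from `x` is unchanged, so the ratio carries over to the total only because
    -- it is at least 1.
    have h5 := one_le_sampleRatio hσ hr
    calc _ ≤ ((d + (L.map fun p => wordDist u ((w.drop p).take l)).sum : ℕ) : ℝ) := by
          exact_mod_cast h4
      _ ≤ d + sampleRatio σ r * ((L.map fun p => wordDist (h x) ((w.drop p).take l)).sum : ℕ) := by
          push_cast at hd ⊢
          linarith
      _ ≤ _ := by
          have : (0 : ℝ) ≤ d := Nat.cast_nonneg d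
          push_cast
          nlinarith
  by_cases hmem : Sum.inr x ∈ α
  · refine key h hw ?_
    obtain ⟨d, L, -, hL2, hL3, -⟩ := exists_occurrences h x α w hw
    have : 0 < α.count (Sum.inr x) := List.count_pos_iff.2 hmem
    nlinarith
  · have hsub := subst_update_of_notMem h hmem []
    have := key (Function.update h x []) (by rw [hsub, hw]) (by simp)
    rwa [hsub] at this

theorem patDist_le (h : ℕ → PWord σ) (hw : (α.subst h).length = w.length) :
    patDist α w ≤ wordDist (α.subst h) w := iInf₂_le h hw

theorem exists_patDist_eq (h : patDist α w ≠ ⊤) :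
    ∃ g : ℕ → PWord σ, (α.subst g).length = w.length ∧ patDist α w = wordDist (α.subst g) w := by
  classical
  have hex : ∃ d : ℕ, ∃ g : ℕ → PWord σ,
      (α.subst g).length = w.length ∧ wordDist (α.subst g) w = d := by
    by_contra hno
    push Not at hno
    apply h
    rw [patDist]
    simp only [iInf_eq_top]
    intro g hg
    exact absurd rfl (hno _ g hg)
  obtain ⟨g, hg, hd⟩ := Nat.find_spec hex
  refine ⟨g, hg, le_antisymm (patDist_le g hg) ?_⟩
  rw [patDist, hd]
  refine le_iInf₂ fun g' hg' => ?_
  exact_mod_cast Nat.find_min' hex ⟨g', hg', rfl⟩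

/-- The best candidate is an acceptable answer. -/
theorem isApproxOutput_bestDist (hσ : 0 < σ) {r : ℕ} (hr : 3 ≤ r)
    (hinp : ∀ j (hj : j < w.length), inp j = symCode (Sum.inl w[j]))
    (hα : ∀ j (hj : j < α.length), inp (w.length + j) = symCode α[j]) {x : ℕ}
    (hx : ∀ y, y ≠ x → α.count (Sum.inr y) ≤ 1) {best : ℕ}
    (hbest : best = bestDist σ w.length r inp α.length (symCode (σ := σ) (Sum.inr x))
      (α.count (Sum.inr x)) ((w.length + 1) ^ (r + 1))) :
    IsApproxOutput (sampleRatio σ r) α w (if best < w.length + 1 then best + 1 else 0) := by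
  by_cases hb : best < w.length + 1
  · right
    rw [if_pos hb]
    obtain ⟨T, hT⟩ := exists_bestDist_eq (hbest ▸ Nat.lt_succ_iff.1 hb)
    rw [← hbest] at hT
    -- Soundness: the winning candidate is a word, so its row entry is the distance of an actual
    -- substitution.
    obtain ⟨u, hu, hmaj⟩ := exists_majorityWord hσ w.length r inp T (T % (w.length + 1))
    have hrow := isRowOf_patternRow (u := u) hinp hα hmaj hx
    rw [candidateDist, ← hu] at hT
    obtain ⟨_, ⟨h, -, rfl⟩, hl, hd⟩ := hrow.attained w.length le_rfl (by omega)
    rw [List.take_length, ← hT] at hd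
    refine ⟨h, hl, by rw [hd], ?_⟩
    have hne : patDist α w ≠ ⊤ := ne_top_of_le_ne_top (ENat.natCast_ne_top _) (patDist_le h hl)
    obtain ⟨g, hg, hgd⟩ := exists_patDist_eq hne
    obtain ⟨T', hT', hm', hn', hc⟩ := exists_candidate hσ hr hinp hα hx g hg
    rw [hgd, ENat.toNat_natCast, hd]
    refine le_trans ?_ hc
    rw [hbest]
    exact_mod_cast bestDist_le hT' hm'
  · left
    refine ⟨?_, by rw [if_neg hb]⟩
    by_contra hne
    obtain ⟨g, hg, hgd⟩ := exists_patDist_eq hne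
    obtain ⟨T', hT', hm', hn', hc⟩ := exists_candidate hσ hr hinp hα hx g hg
    exact hb ((hbest.trans_le ((bestDist_le hT' hm').trans hn')).trans_lt (Nat.lt_succ_self _))

end Approximation

/-! ### Verification of RAM programs -/

section Ram

@[simp]
theorem RamState.setReg_reg (s : RamState) (d v i : ℕ) :
    (s.setReg d v).reg i = if i = d then v else s.reg i := Function.update_apply ..

@[simp]
theorem RamState.setReg_mem (s : RamState) (d v : ℕ) : (s.setReg d v).mem = s.mem := rfl

@[simp]
theorem RamState.setMem_reg (s : RamState) (a v : ℕ) : (s.setMem a v).reg = s.reg := rfl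

@[simp]
theorem RamState.setMem_mem (s : RamState) (a v i : ℕ) :
    (s.setMem a v).mem i = if i = a then v else s.mem i := Function.update_apply ..

/-! ### Frame conditions and total correctness -/

/-- All registers that `p` writes are numbered from `L` on. -/
def RamProg.writesFrom (L : ℕ) : RamProg → Bool
  | .skip => true
  | .const d _ => L ≤ d
  | .op _ d _ _ => L ≤ d
  | .load d _ => L ≤ d
  | .store _ _ => true
  | .seq p q => p.writesFrom L && q.writesFrom L
  | .ite _ p q => p.writesFrom L && q.writesFrom L
  | .while _ p => p.writesFrom L

/-- `p` has no `store` instruction. -/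
def RamProg.noStore : RamProg → Bool
  | .store _ _ => false
  | .seq p q => p.noStore && q.noStore
  | .ite _ p q => p.noStore && q.noStore
  | .while _ p => p.noStore
  | _ => true

/-- Frame rule with a syntactic side condition, which `rfl` discharges for concrete programs. -/
theorem RamRun.reg_eq {W : ℕ} {p : RamProg} {s s' : RamState} {k L i : ℕ}
    (h : RamRun W p s k s') (hp : p.writesFrom L = true) (hi : i < L) : s'.reg i = s.reg i := by
  induction h with
  | skip | store | while_false => rfl
  | const | op | load =>
    simp only [RamProg.writesFrom, decide_eq_true_eq] at hp
    rw [RamState.setReg_reg, if_neg (by omega)]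
  | seq _ _ ih1 ih2 =>
    simp only [RamProg.writesFrom, Bool.and_eq_true] at hp
    rw [ih2 hp.2, ih1 hp.1]
  | ite_true _ _ ih =>
    simp only [RamProg.writesFrom, Bool.and_eq_true] at hp
    exact ih hp.1
  | ite_false _ _ ih =>
    simp only [RamProg.writesFrom, Bool.and_eq_true] at hp
    exact ih hp.2
  | while_true _ _ _ ih1 ih2 => rw [ih2 hp, ih1 hp]

theorem RamRun.mem_eq {W : ℕ} {p : RamProg} {s s' : RamState} {k : ℕ}
    (h : RamRun W p s k s') (hp : p.noStore = true) : s'.mem = s.mem := by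
  induction h with
  | skip | const | op | load | while_false => rfl
  | store => cases hp
  | seq _ _ ih1 ih2 =>
    simp only [RamProg.noStore, Bool.and_eq_true] at hp
    rw [ih2 hp.2, ih1 hp.1]
  | ite_true _ _ ih =>
    simp only [RamProg.noStore, Bool.and_eq_true] at hp
    exact ih hp.1
  | ite_false _ _ ih =>
    simp only [RamProg.noStore, Bool.and_eq_true] at hp
    exact ih hp.2
  | while_true _ _ _ ih1 ih2 => rw [ih2 hp, ih1 hp]

/-- Started in the state `s`, the program `p` halts after at most `K` steps in a state that
satisfies `Q`. -/
def Halts (W : ℕ) (p : RamProg) (s : RamState) (K : ℕ) (Q : RamState → Prop) : Prop :=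
  ∃ (k : ℕ) (s' : RamState), k ≤ K ∧ RamRun W p s k s' ∧ Q s'

section Halts

variable {W : ℕ} {p q : RamProg} {s : RamState} {K K' L : ℕ} {Q R : RamState → Prop}

theorem Halts.mono (h : Halts W p s K Q) (hK : K ≤ K') (hQ : ∀ s', Q s' → R s') :
    Halts W p s K' R := by
  obtain ⟨k, s', hk, hr, hs'⟩ := h
  exact ⟨k, s', hk.trans hK, hr, hQ s' hs'⟩

theorem Halts.frame (h : Halts W p s K Q) (hp : p.writesFrom L = true) :
    Halts W p s K fun s' => Q s' ∧ ∀ i < L, s'.reg i = s.reg i := by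
  obtain ⟨k, s', hk, hr, hs'⟩ := h
  exact ⟨k, s', hk, hr, hs', fun i hi => hr.reg_eq hp hi⟩

theorem Halts.frame_mem (h : Halts W p s K Q) (hp : p.noStore = true) :
    Halts W p s K fun s' => Q s' ∧ s'.mem = s.mem := by
  obtain ⟨k, s', hk, hr, hs'⟩ := h
  exact ⟨k, s', hk, hr, hs', hr.mem_eq hp⟩

theorem Halts.seq (hp : Halts W p s K R) (hq : ∀ s', R s' → Halts W q s' K' Q) :
    Halts W (.seq p q) s (K + K') Q := by
  obtain ⟨k, s', hk, hr, hs'⟩ := hp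
  obtain ⟨k', s'', hk', hr', hs''⟩ := hq s' hs'
  exact ⟨k + k', s'', by omega, .seq hr hr', hs''⟩

theorem Halts.ite {t : RamTest} (hp : t.Holds s → Halts W p s K Q)
    (hq : ¬ t.Holds s → Halts W q s K Q) : Halts W (.ite t p q) s (K + 1) Q := by
  by_cases ht : t.Holds s
  · obtain ⟨k, s', hk, hr, hs'⟩ := hp ht
    exact ⟨k + 1, s', by omega, .ite_true ht hr, hs'⟩
  · obtain ⟨k, s', hk, hr, hs'⟩ := hq ht
    exact ⟨k + 1, s', by omega, .ite_false ht hr, hs'⟩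

end Halts

/-- The weakest precondition of a program without loops. -/
@[simp]
def RamProg.wp (W : ℕ) : RamProg → (RamState → Prop) → RamState → Prop
  | .skip, Q, s => Q s
  | .const d k, Q, s => k < W ∧ Q (s.setReg d k)
  | .op f d a b, Q, s =>
    f.eval (s.reg a) (s.reg b) < W ∧ Q (s.setReg d (f.eval (s.reg a) (s.reg b)))
  | .load d a, Q, s => s.reg a < W ∧ s.mem (s.reg a) < W ∧ Q (s.setReg d (s.mem (s.reg a)))
  | .store a b, Q, s => s.reg a < W ∧ s.reg b < W ∧ Q (s.setMem (s.reg a) (s.reg b))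
  | .seq p q, Q, s => p.wp W (q.wp W Q) s
  | .ite t p q, Q, s => (t.Holds s → p.wp W Q s) ∧ (¬ t.Holds s → q.wp W Q s)
  | .while _ _, _, _ => False

/-- The number of steps of a program without loops. -/
@[simp]
def RamProg.cost : RamProg → ℕ
  | .seq p q => p.cost + q.cost
  | .ite _ p q => max p.cost q.cost + 1
  | _ => 1

/-- Loop-free code is verified by unfolding `wp` with `simp`, which leaves word-size bounds and
arithmetic. -/
theorem Halts.of_wp {W : ℕ} {p : RamProg} {s : RamState} {Q : RamState → Prop}
    (h : p.wp W Q s) : Halts W p s p.cost Q := by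
  induction p generalizing s Q with
  | skip => exact ⟨1, _, le_rfl, .skip s, h⟩
  | const d k => exact ⟨1, _, le_rfl, .const s d k h.1, h.2⟩
  | op f d a b => exact ⟨1, _, le_rfl, .op s f d a b h.1, h.2⟩
  | load d a => exact ⟨1, _, le_rfl, .load s d a h.1 h.2.1, h.2.2⟩
  | store a b => exact ⟨1, _, le_rfl, .store s a b h.1 h.2.1, h.2.2⟩
  | seq p q ihp ihq => exact (ihp h).seq fun s' hs' => ihq hs'
  | ite t p q ihp ihq =>
    exact .ite (fun ht => (ihp (h.1 ht)).mono (le_max_left _ _) fun _ => id)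
      fun ht => (ihq (h.2 ht)).mono (le_max_right _ _) fun _ => id
  | _ => exact h.elim

/-- Sequential composition. -/
@[simp]
def RamProg.block : List RamProg → RamProg
  | [] => .skip
  | [p] => p
  | p :: ps => .seq p (block ps)

/-- Copying register `a` to register `d`; register `2` holds the number `1`. -/
@[simp]
def RamProg.move (d a : ℕ) : RamProg := .op .mul d a 2

/-- Executing `p` while register `i` runs from `0` to the number in register `b`, exclusively. -/
def RamProg.forLoop (i b : ℕ) (p : RamProg) : RamProg :=
  .seq (.const i 0) (.while (.lt i b) (.seq p (.op .add i i 2)))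

/-- The body writes only registers above the counter, so the counter, the bound and all data of
enclosing loops survive each round without being part of the invariant. Nested loops therefore use
increasing registers. The cost may depend on the round because pattern symbols have unequal costs.
-/
theorem halts_forLoop {W i b N : ℕ} {p : RamProg} {s : RamState} (Inv : ℕ → RamState → Prop)
    (K : ℕ → ℕ) (hi : 2 < i) (hb : b < i) (hN : s.reg b = N) (hone : s.reg 2 = 1) (hW : N < W)
    (hp : p.writesFrom (i + 1) = true) (h0 : Inv 0 (s.setReg i 0))
    (hstep : ∀ j < N, ∀ s' : RamState, s'.reg i = j → (∀ x < i, s'.reg x = s.reg x) → Inv j s' →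
      Halts W p s' (K j) fun s'' => Inv (j + 1) (s''.setReg i (j + 1))) :
    Halts W (.forLoop i b p) s (∑ j ∈ Finset.range N, (K j + 2) + 2)
      fun s' => Inv N s' ∧ ∀ x < i, s'.reg x = s.reg x := by
  have key : ∀ d j, j + d = N → ∀ s' : RamState, s'.reg i = j → (∀ x < i, s'.reg x = s.reg x) →
      Inv j s' → Halts W (.while (.lt i b) (.seq p (.op .add i i 2))) s'
        (∑ j ∈ Finset.Ico j N, (K j + 2) + 1)
        fun s' => Inv N s' ∧ ∀ x < i, s'.reg x = s.reg x := by
    intro d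
    induction d with
    | zero =>
      intro j hj s' hs' hfr hinv
      obtain rfl : j = N := by omega
      refine ⟨1, s', by omega, .while_false ?_, hinv, hfr⟩
      rw [RamTest.Holds, hs', hfr b hb, hN]
      exact lt_irrefl _
    | succ d ih =>
      intro j hj s' hs' hfr hinv
      obtain ⟨k, s1, hk, hr, hinv1⟩ := hstep j (by omega) s' hs' hfr hinv
      have hfr1 : ∀ x < i + 1, s1.reg x = s'.reg x := fun x hx => hr.reg_eq hp hx
      have h1i : s1.reg i = j := by rw [hfr1 i (by omega), hs']
      have h12 : s1.reg 2 = 1 := by rw [hfr1 2 (by omega), hfr 2 hi, hone]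
      have hinc := RamRun.op (W := W) s1 .add i i 2 (by
        rw [h1i, h12, BinOp.eval]; omega)
      rw [h1i, h12, BinOp.eval] at hinc
      obtain ⟨k', s2, hk', hr', hQ⟩ := ih (j + 1) (by omega) (s1.setReg i (j + 1))
        (by simp) (fun x hx => by
          rw [RamState.setReg_reg, if_neg (by omega), hfr1 x (by omega), hfr x hx]) hinv1
      refine ⟨k + 1 + k' + 1, s2, ?_, .while_true ?_ (.seq hr hinc) hr', hQ⟩
      · rw [Finset.sum_eq_sum_Ico_succ_bot (by omega : j < N)]
        omega
      · rw [RamTest.Holds, hs', hfr b hb, hN]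
        omega
  have hconst := RamRun.const (W := W) s i 0 (by omega)
  obtain ⟨k, s', hk, hr, hQ⟩ := key N 0 (by omega) (s.setReg i 0) (by simp)
    (fun x hx => by rw [RamState.setReg_reg, if_neg (by omega)]) h0
  refine ⟨1 + k, s', ?_, .seq hconst hr, hQ⟩
  rw [Finset.range_eq_Ico]
  omega

end Ram

/-! ### The program -/

section Program

/-- The numbers that have to fit into a machine word. -/
structure Fits (W σ n k r : ℕ) (inp : ℕ → ℕ) : Prop where
  length_le : k ≤ n
  input_lt : ∀ i, inp i < W
  linear_lt : 3 * n + 2 < W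
  alphabet_lt : σ + n + 2 < W
  sample_lt : r + 2 < W
  square_lt : (n + 1) * (n + 1) < W
  power_lt : (n + 1) ^ (r + 1) < W

/-- The registers `0` to `8` hold the parameters. -/
structure HasParams (σ n k r x m : ℕ) (s : RamState) : Prop where
  r0 : s.reg 0 = n
  r1 : s.reg 1 = k
  r2 : s.reg 2 = 1
  r3 : s.reg 3 = n + 1
  r4 : s.reg 4 = 2 * n
  r5 : s.reg 5 = σ
  r6 : s.reg 6 = r
  r7 : s.reg 7 = x
  r8 : s.reg 8 = m

/-- The memory holds the input and a row. -/
structure HasRow (n : ℕ) (inp row : ℕ → ℕ) (s : RamState) : Prop where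
  input : ∀ i < 2 * n, s.mem i = inp i
  row : ∀ j ≤ n, s.mem (2 * n + j) = row j

variable {W σ n k r x m : ℕ} {inp row : ℕ → ℕ} {s : RamState}

theorem HasParams.congr (h : HasParams σ n k r x m s) {s' : RamState} {L : ℕ}
    (hL : 9 ≤ L) (hs : ∀ i < L, s'.reg i = s.reg i) : HasParams σ n k r x m s' := by
  constructor
  · rw [hs _ (by omega), h.r0]
  · rw [hs _ (by omega), h.r1]
  · rw [hs _ (by omega), h.r2]
  · rw [hs _ (by omega), h.r3]
  · rw [hs _ (by omega), h.r4]
  · rw [hs _ (by omega), h.r5]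
  · rw [hs _ (by omega), h.r6]
  · rw [hs _ (by omega), h.r7]
  · rw [hs _ (by omega), h.r8]

theorem HasRow.congr (h : HasRow n inp row s) {s' : RamState} (hs : s'.mem = s.mem) :
    HasRow n inp row s' :=
  ⟨fun i hi => by rw [hs, h.input i hi], fun j hj => by rw [hs, h.row j hj]⟩

/-! ### In-place updates of a row -/

/-- The step of the dynamic program for a letter, whose code is in register `18`. -/
def letterBody : RamProg :=
  .block [.op .sub 20 0 19, .op .add 21 4 20, .op .sub 20 20 2, .load 22 20, .op .sub 23 21 2,
    .load 24 23, .ite (.eq 22 18) .skip (.ite (.lt 24 3) (.op .add 24 24 2) .skip), .store 21 24]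

def letterProg : RamProg :=
  .seq (.forLoop 19 0 letterBody) (.store 4 3)

/-- Entry `j + 1` of the new row needs entry `j` of the old one, so the row is overwritten from the
right. Entry `0` is set to `∞` at the end. -/
theorem halts_letterProg (hF : Fits W σ n k r inp) (hP : HasParams σ n k r x m s)
    (hR : HasRow n inp row s) (hle : ∀ j, row j ≤ n + 1) {c : ℕ} (hc : s.reg 18 = c) :
    Halts W letterProg s (12 * n + 3) (HasRow n inp (letterRow n inp c row)) := by
  have hlin := hF.linear_lt
  have hloop := halts_forLoop (W := W) (i := 19) (b := 0) (p := letterBody) (s := s) (N := n)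
    (fun j s' => HasRow n inp (fun i => if n < i + j then letterRow n inp c row i else row i) s')
    (fun _ => 10) (by omega) (by omega) hP.r0 hP.r2 (by omega) rfl
    (by
      refine ⟨fun i hi => hR.input i hi, fun j hj => ?_⟩
      rw [if_neg (by omega)]
      exact hR.row j hj)
    (by
      intro j hj s' hs' hfr hinv
      have h0 : s'.reg 0 = n := by rw [hfr _ (by omega), hP.r0]
      have h2 : s'.reg 2 = 1 := by rw [hfr _ (by omega), hP.r2]
      have h3 : s'.reg 3 = n + 1 := by rw [hfr _ (by omega), hP.r3]
      have h4 : s'.reg 4 = 2 * n := by rw [hfr _ (by omega), hP.r4]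
      have h18 : s'.reg 18 = c := by rw [hfr _ (by omega), hc]
      -- Round `j` reads the old entry `q = n - j - 1` and writes entry `q + 1`.
      obtain ⟨q, hq⟩ : ∃ q, n = j + q + 1 := ⟨n - j - 1, by omega⟩
      have e1 : n - j = q + 1 := by omega
      have e2 : 2 * n + (q + 1) - 1 = 2 * n + q := by omega
      have hm1 : s'.mem q = inp q := hinv.input q (by omega)
      have hm2 : s'.mem (2 * n + q) = row q := by
        rw [hinv.row q (by omega), if_neg (by omega)]
      have hi1 := hF.input_lt q
      have hr1 := hle q
      have hfin : ∀ v, v = letterRow n inp c row (q + 1) → ∀ s'' : RamState,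
          (∀ i, s''.mem i = if i = 2 * n + (q + 1) then v else s'.mem i) →
          HasRow n inp (fun i => if n < i + (j + 1) then letterRow n inp c row i else row i) s'' := by
        intro v hv s'' hmem
        refine ⟨fun i hi => ?_, fun i hi => ?_⟩
        · rw [hmem, if_neg (by omega), hinv.input i hi]
        · rw [hmem]
          by_cases hiq : i = q + 1
          · subst hiq
            rw [if_pos rfl, if_pos (by omega), hv]
          · rw [if_neg (by omega), hinv.row i hi]
            exact if_congr (by omega) rfl rfl
      refine (Halts.of_wp (p := letterBody) ?_).mono (by decide) fun _ => id
      simp only [letterBody, RamProg.block, RamProg.wp, BinOp.eval, RamState.setReg_reg,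
        RamState.setReg_mem, RamTest.Holds, Nat.reduceEqDiff, if_true, if_false, h0, h2, h3, h4, h18, hs', e1, e2, hm1, hm2, Nat.add_sub_cancel]
      refine ⟨by omega, by omega, by omega, by omega, by omega, by omega, by omega, by omega,
        fun hcq => ⟨by omega, by omega, ?_⟩,
        fun hcq => ⟨fun hlt => ⟨by omega, by omega, by omega, ?_⟩,
          fun hlt => ⟨by omega, by omega, ?_⟩⟩⟩
      · refine hfin (row q) ?_ _ fun i => by simp
        rw [letterRow, if_pos hcq]
      · refine hfin (row q + 1) ?_ _ fun i => by simp
        rw [letterRow, if_neg hcq, if_pos hlt]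
      · refine hfin (row q) ?_ _ fun i => by simp
        rw [letterRow, if_neg hcq, if_neg hlt])
  refine (hloop.seq (K' := 1) (Q := HasRow n inp (letterRow n inp c row)) ?_).mono (by simp; omega)
    fun _ => id
  rintro s' ⟨hinv, hfr⟩
  refine Halts.of_wp (p := .store 4 3) ?_
  have h3 : s'.reg 3 = n + 1 := by rw [hfr _ (by omega), hP.r3]
  have h4 : s'.reg 4 = 2 * n := by rw [hfr _ (by omega), hP.r4]
  refine ⟨by rw [h4]; omega, by rw [h3]; omega, ?_⟩
  rw [h3, h4]
  refine ⟨fun i hi => ?_, fun i hi => ?_⟩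
  · rw [RamState.setMem_mem, if_neg (by omega), hinv.input i hi]
  · rw [RamState.setMem_mem]
    by_cases h0 : i = 0
    · subst h0
      rw [if_pos (by omega), letterRow]
    · rw [if_neg (by omega), hinv.row i hi, if_pos (by omega)]

/-- The step of the dynamic program for a variable that occurs only once. -/
def varBody : RamProg :=
  .block [.op .add 20 4 19, .op .add 21 20 2, .load 22 20, .load 23 21,
    .ite (.lt 22 23) (.store 21 22) .skip]

def varProg : RamProg := .forLoop 19 0 varBody

/-- Prefix minima use the new entry to the left, so this pass runs from the left. -/
theorem halts_varProg (hF : Fits W σ n k r inp) (hP : HasParams σ n k r x m s)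
    (hR : HasRow n inp row s) (hle : ∀ j, row j ≤ n + 1) :
    Halts W varProg s (8 * n + 2) (HasRow n inp (varRow row)) := by
  have hlin := hF.linear_lt
  have hloop := halts_forLoop (W := W) (i := 19) (b := 0) (p := varBody) (s := s) (N := n)
    (fun j s' => HasRow n inp (fun i => if i ≤ j then varRow row i else row i) s')
    (fun _ => 6) (by omega) (by omega) hP.r0 hP.r2 (by omega) rfl
    (by
      refine ⟨fun i hi => hR.input i hi, fun j hj => ?_⟩
      rw [RamState.setReg_mem, hR.row j hj]
      split_ifs with h
      · rw [Nat.le_zero.1 h]; rfl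
      · rfl)
    (by
      intro j hj s' hs' hfr hinv
      have h2 : s'.reg 2 = 1 := by rw [hfr _ (by omega), hP.r2]
      have h4 : s'.reg 4 = 2 * n := by rw [hfr _ (by omega), hP.r4]
      have hm1 : s'.mem (2 * n + j) = varRow row j := by
        rw [hinv.row j (by omega), if_pos le_rfl]
      have hm2 : s'.mem (2 * n + j + 1) = row (j + 1) := by
        rw [add_assoc, hinv.row (j + 1) (by omega), if_neg (by omega)]
      have hr1 := (varRow_le row (le_refl j)).trans (hle j)
      have hr2 := hle (j + 1)
      have hmin : varRow row (j + 1) = min (row (j + 1)) (varRow row j) := rfl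
      refine (Halts.of_wp (p := varBody) ?_).mono (by decide) fun _ => id
      simp only [varBody, RamProg.block, RamProg.wp, BinOp.eval, RamState.setReg_reg,
        RamState.setReg_mem, RamTest.Holds, Nat.reduceEqDiff,
        reduceIte, h2, h4, hs', hm1, hm2]
      refine ⟨by omega, by omega, by omega, by omega, by omega, by omega,
        fun hlt => ⟨by omega, by omega, ?_⟩, fun hlt => ?_⟩
      · refine ⟨fun i hi => ?_, fun i hi => ?_⟩
        · simp only [RamState.setReg_mem, RamState.setMem_mem]
          rw [if_neg (by omega), hinv.input i hi]
        · simp only [RamState.setReg_mem, RamState.setMem_mem]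
          by_cases hij : i = j + 1
          · subst hij
            rw [if_pos (by omega), if_pos le_rfl, hmin, min_eq_right hlt.le]
          · rw [if_neg (by omega), hinv.row i hi]
            exact if_congr (by omega) rfl rfl
      · refine ⟨fun i hi => ?_, fun i hi => ?_⟩
        · simp only [RamState.setReg_mem]
          rw [hinv.input i hi]
        · simp only [RamState.setReg_mem]
          rw [hinv.row i hi]
          by_cases hij : i = j + 1
          · subst hij
            rw [if_neg (by omega), if_pos le_rfl, hmin, min_eq_left (not_lt.1 hlt)]
          · exact if_congr (by omega) rfl rfl)
  refine hloop.mono (by simp; omega) ?_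
  rintro s' ⟨hinv, -⟩
  refine ⟨hinv.input, fun j hj => ?_⟩
  rw [hinv.row j hj, if_pos hj]

def initBody : RamProg := .block [.op .add 15 4 14, .store 15 3]

def initProg : RamProg :=
  .seq (.forLoop 14 3 initBody) (.block [.const 15 0, .store 4 15])

theorem halts_initProg (hF : Fits W σ n k r inp) (hP : HasParams σ n k r x m s)
    (hI : ∀ i < 2 * n, s.mem i = inp i) :
    Halts W initProg s (4 * n + 8) (HasRow n inp (initRow n)) := by
  have hlin := hF.linear_lt
  have hloop := halts_forLoop (W := W) (i := 14) (b := 3) (p := initBody) (s := s) (N := n + 1)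
    (fun j s' => (∀ i < 2 * n, s'.mem i = inp i) ∧ ∀ i < j, s'.mem (2 * n + i) = n + 1)
    (fun _ => 2) (by omega) (by omega) hP.r3 hP.r2 (by omega) rfl
    ⟨hI, fun i hi => absurd hi (Nat.not_lt_zero i)⟩
    (by
      rintro j hj s' hs' hfr ⟨hinv1, hinv2⟩
      have h3 : s'.reg 3 = n + 1 := by rw [hfr _ (by omega), hP.r3]
      have h4 : s'.reg 4 = 2 * n := by rw [hfr _ (by omega), hP.r4]
      refine (Halts.of_wp (p := initBody) ?_).mono (by decide) fun _ => id
      simp only [initBody, RamProg.block, RamProg.wp, BinOp.eval, RamState.setReg_reg,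
        Nat.reduceEqDiff, if_true, if_false, h3, h4, hs']
      refine ⟨by omega, by omega, by omega, fun i hi => ?_, fun i hi => ?_⟩
      · simp only [RamState.setReg_mem, RamState.setMem_mem]
        rw [if_neg (by omega), hinv1 i hi]
      · simp only [RamState.setReg_mem, RamState.setMem_mem]
        by_cases hij : i = j
        · rw [if_pos (by omega)]
        · rw [if_neg (by omega), hinv2 i (by omega)])
  refine (hloop.seq (K' := 2) (Q := HasRow n inp (initRow n)) ?_).mono (by simp; omega)
    fun _ => id
  rintro s' ⟨⟨hinv1, hinv2⟩, hfr⟩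
  refine Halts.of_wp (p := .block [.const 15 0, .store 4 15]) ?_
  have h4 : s'.reg 4 = 2 * n := by rw [hfr _ (by omega), hP.r4]
  simp only [RamProg.block, RamProg.wp, RamState.setReg_reg, Nat.reduceEqDiff, if_true, if_false, h4]
  refine ⟨by omega, by omega, by omega, fun i hi => ?_, fun i hi => ?_⟩
  · simp only [RamState.setReg_mem, RamState.setMem_mem]
    rw [if_neg (by omega), hinv1 i hi]
  · simp only [RamState.setReg_mem, RamState.setMem_mem, initRow]
    by_cases h0 : i = 0
    · rw [if_pos (by omega), if_pos h0]
    · rw [if_neg (by omega), if_neg h0, hinv2 i (by omega)]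

/-! ### Majority votes -/

/-- Counting the votes for the letter whose code is in register `20`. -/
def voteBody : RamProg :=
  .block [.op .mod 24 23 3, .op .add 24 24 16, .load 24 24,
    .ite (.eq 24 20) (.op .add 22 22 2) .skip, .op .div 23 23 3]

def voteProg : RamProg :=
  .seq (.block [.op .add 20 17 2, .const 22 0, .op .div 23 10 3]) (.forLoop 21 6 voteBody)

theorem samplePos_le (n T i : ℕ) : samplePos n T i ≤ n :=
  Nat.lt_succ_iff.1 (Nat.mod_lt _ (Nat.succ_pos n))

theorem codeVotes_le (n r : ℕ) (inp : ℕ → ℕ) (T j a : ℕ) : codeVotes n r inp T j a ≤ r :=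
  Nat.count_le _

theorem halts_voteProg (hF : Fits W σ n k r inp) (hP : HasParams σ n k r x m s)
    (hI : ∀ i < 2 * n, s.mem i = inp i) {T j a : ℕ} (hT : s.reg 10 = T) (hTW : T < W)
    (hj : s.reg 16 = j) (hjn : j < n) (ha : s.reg 17 = a) (haσ : a < σ) :
    Halts W voteProg s (8 * r + 5) fun s' =>
      s'.reg 20 = a + 1 ∧ s'.reg 22 = codeVotes n r inp T j (a + 1) := by
  have hlin := hF.linear_lt
  have hsam := hF.sample_lt
  have halp := hF.alphabet_lt
  have hdiv : T / (n + 1) < W := (Nat.div_le_self _ _).trans_lt hTW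
  have hpre : Halts W (.block [.op .add 20 17 2, .const 22 0, .op .div 23 10 3]) s 3
      fun s' => (s'.reg 20 = a + 1 ∧ s'.reg 22 = 0 ∧ s'.reg 23 = T / (n + 1)) := by
    refine Halts.of_wp ?_
    simp only [RamProg.block, RamProg.wp, BinOp.eval, RamState.setReg_reg,
      Nat.reduceEqDiff, if_true, if_false, hP.r2, hP.r3, hT, ha]
    refine ⟨by omega, by omega, hdiv, trivial, trivial, trivial⟩
  refine (((hpre.frame (L := 20) rfl).frame_mem rfl).seq (K' := 8 * r + 2) ?_).mono
    (by omega) fun _ => id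
  rintro s1 ⟨⟨⟨h20, h22, h23⟩, hfr⟩, hmem⟩
  have hP1 := hP.congr (by omega) hfr
  have hloop := halts_forLoop (W := W) (i := 21) (b := 6) (p := voteBody) (s := s1) (N := r)
    -- Register `23` holds the digits not yet read; the exponent is `i + 1` because the length digit
    -- is dropped before the loop.
    (fun i s' => s'.reg 22 = Nat.count (fun i => inp (samplePos n T i + j) = a + 1) i ∧
      s'.reg 23 = T / (n + 1) ^ (i + 1) ∧ s'.mem = s.mem)
    (fun _ => 6) (by omega) (by omega) hP1.r6 hP1.r2 (by omega) rfl
    (by simp [h22, h23, hmem])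
    (by
      rintro i hi s' hs' hfr' ⟨h22', h23', hmem'⟩
      have h2 : s'.reg 2 = 1 := by rw [hfr' _ (by omega), hP1.r2]
      have h3 : s'.reg 3 = n + 1 := by rw [hfr' _ (by omega), hP1.r3]
      have h16 : s'.reg 16 = j := by rw [hfr' _ (by omega), hfr _ (by omega), hj]
      have h20' : s'.reg 20 = a + 1 := by rw [hfr' _ (by omega), h20]
      have hpos : T / (n + 1) ^ (i + 1) % (n + 1) = samplePos n T i := rfl
      have hpos_le := samplePos_le n T i
      -- The address is at most `n + (n - 1)`, hence below the row, which starts at `2 * n`.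
      have hm1 : s'.mem (samplePos n T i + j) = inp (samplePos n T i + j) := by
        rw [hmem', hI _ (by omega)]
      have hi1 := hF.input_lt (samplePos n T i + j)
      have hcount : Nat.count (fun i => inp (samplePos n T i + j) = a + 1) i ≤ i :=
        Nat.count_le _
      have hsucc := Nat.count_succ (fun i => inp (samplePos n T i + j) = a + 1) i
      have hdd : T / (n + 1) ^ (i + 1) / (n + 1) = T / (n + 1) ^ (i + 1 + 1) := by
        rw [Nat.div_div_eq_div_mul, ← pow_succ]
      have hdW : T / (n + 1) ^ (i + 1 + 1) < W := (Nat.div_le_self _ _).trans_lt hTW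
      refine (Halts.of_wp (p := voteBody) ?_).mono (by decide) fun _ => id
      simp only [voteBody, RamProg.block, RamProg.wp, BinOp.eval, RamState.setReg_reg,
        RamState.setReg_mem, RamTest.Holds, Nat.reduceEqDiff, if_true, if_false, h2, h3, h16, h20',
        h22', h23', hpos, hm1, hdd, hmem']
      refine ⟨by omega, by omega, by omega, hi1, fun heq => ⟨by omega, hdW, ?_, trivial, trivial⟩,
        fun hne => ⟨hdW, ?_, trivial, trivial⟩⟩
      · rw [hsucc, if_pos heq]
      · rw [hsucc, if_neg hne, add_zero])
  refine hloop.mono (by simp; omega) ?_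
  rintro s' ⟨⟨h22', -, -⟩, hfr'⟩
  exact ⟨by rw [hfr' _ (by omega), h20], h22'⟩

/-- Computing the majority letter at the offset in register `16`. -/
def majorityProg : RamProg :=
  .seq (.block [.const 18 1, .const 19 0])
    (.forLoop 17 5 (.seq voteProg (.ite (.lt 19 22) (.block [.move 18 20, .move 19 22]) .skip)))

theorem halts_majorityProg (hF : Fits W σ n k r inp) (hP : HasParams σ n k r x m s)
    (hI : ∀ i < 2 * n, s.mem i = inp i) {T j : ℕ} (hT : s.reg 10 = T) (hTW : T < W)
    (hj : s.reg 16 = j) (hjn : j < n) :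
    Halts W majorityProg s ((8 * r + 10) * σ + 4) fun s' =>
      s'.reg 18 = majorityCode σ n r inp T j ∧ s'.mem = s.mem := by
  have hlin := hF.linear_lt
  have hsam := hF.sample_lt
  have halp := hF.alphabet_lt
  have hpre : Halts W (.block [.const 18 1, .const 19 0]) s 2
      fun s' => (s'.reg 18 = 1 ∧ s'.reg 19 = 0) := by
    refine Halts.of_wp ?_
    simp only [RamProg.block, RamProg.wp, RamState.setReg_reg,
      Nat.reduceEqDiff, if_true, if_false]
    exact ⟨by omega, by omega, trivial, trivial⟩
  refine (((hpre.frame (L := 18) rfl).frame_mem rfl).seq (K' := (8 * r + 10) * σ + 2) ?_).mono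
    (by omega) fun _ => id
  rintro s1 ⟨⟨⟨h18, h19⟩, hfr⟩, hmem⟩
  have hP1 := hP.congr (by omega) hfr
  set f := codeVotes n r inp T j with hf
  have hloop := halts_forLoop (W := W) (i := 17) (b := 5)
    (p := .seq voteProg (.ite (.lt 19 22) (.block [.move 18 20, .move 19 22]) .skip))
    (s := s1) (N := σ)
    (fun a s' => s'.reg 18 = (argmaxVotes f a).1 ∧ s'.reg 19 = (argmaxVotes f a).2 ∧
      s'.mem = s.mem)
    (fun _ => 8 * r + 8) (by omega) (by omega) hP1.r5 hP1.r2 (by omega) rfl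
    (by simp [h18, h19, hmem, argmaxVotes])
    (by
      rintro a ha s' hs' hfr' ⟨h18', h19', hmem'⟩
      have hP' := hP1.congr (by omega) hfr'
      have hvote := halts_voteProg hF hP' (fun i hi => by rw [hmem', hI i hi]) (T := T) (j := j)
        (by rw [hfr' _ (by omega), hfr _ (by omega), hT]) hTW
        (by rw [hfr' _ (by omega), hfr _ (by omega), hj]) hjn hs' ha
      refine (((hvote.frame (L := 20) rfl).frame_mem rfl).seq (K' := 3) ?_).mono (by omega)
        fun _ => id
      rintro s2 ⟨⟨⟨h20, h22⟩, hfr2⟩, hmem2⟩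
      have h2 : s2.reg 2 = 1 := by rw [hfr2 _ (by omega), hP'.r2]
      have h18'' : s2.reg 18 = (argmaxVotes f a).1 := by rw [hfr2 _ (by omega), h18']
      have h19'' : s2.reg 19 = (argmaxVotes f a).2 := by rw [hfr2 _ (by omega), h19']
      have hfle : f (a + 1) ≤ r := codeVotes_le n r inp T j (a + 1)
      refine (Halts.of_wp ?_).mono (K := RamProg.cost _) (by decide) fun _ => id
      simp only [RamProg.block, RamProg.wp, RamProg.move, BinOp.eval, RamState.setReg_reg,
        RamState.setReg_mem, RamTest.Holds, Nat.reduceEqDiff, if_true, if_false, h2, h18'', h19'',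
        h20, h22, ← hf, mul_one, hmem2, hmem', and_true]
      rw [argmaxVotes]
      refine ⟨fun hlt => ⟨by omega, by omega, ?_, ?_⟩, fun hlt => ⟨?_, ?_⟩⟩
      · rw [if_pos hlt]
      · rw [if_pos hlt]
      · rw [if_neg hlt]
      · rw [if_neg hlt])
  refine hloop.mono (by simp; apply le_of_eq; ring) ?_
  rintro s' ⟨⟨h18', -, hm⟩, -⟩
  exact ⟨h18', hm⟩

/-! ### The dynamic program for one candidate -/

/-- The steps of the dynamic program for an occurrence of the repeated variable. -/
def wordProg : RamProg := .forLoop 16 12 (.seq majorityProg letterProg)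

theorem halts_wordProg (hF : Fits W σ n k r inp) (hP : HasParams σ n k r x m s)
    (hR : HasRow n inp row s) (hle : ∀ j, row j ≤ n + 1) {T l : ℕ} (hT : s.reg 10 = T)
    (hTW : T < W) (hl : s.reg 12 = l) (hln : l ≤ n) :
    Halts W wordProg s (l * (12 * n + (8 * r + 10) * σ + 9) + 2)
      (HasRow n inp (wordRow n inp (majorityCode σ n r inp T) row l)) := by
  have hlin := hF.linear_lt
  have hloop := halts_forLoop (W := W) (i := 16) (b := 12) (p := .seq majorityProg letterProg)
    (s := s) (N := l)
    (fun j s' => HasRow n inp (wordRow n inp (majorityCode σ n r inp T) row j) s')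
    (fun _ => 12 * n + (8 * r + 10) * σ + 7) (by omega) (by omega) hl hP.r2 (by omega) rfl
    (hR.congr rfl)
    (by
      intro j hj s' hs' hfr hinv
      have hP' := hP.congr (by omega) hfr
      have hmaj := halts_majorityProg hF hP' hinv.input (T := T) (j := j)
        (by rw [hfr _ (by omega), hT]) hTW hs' (by omega)
      refine ((hmaj.frame (L := 17) rfl).seq (K' := 12 * n + 3) ?_).mono (by omega) fun _ => id
      rintro s2 ⟨⟨h18, hmem⟩, hfr2⟩
      refine (halts_letterProg hF (hP'.congr (by omega) hfr2) (hinv.congr hmem)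
        (wordRow_le hle j) h18).mono le_rfl fun s3 h3 => ?_
      exact h3.congr rfl)
  exact hloop.mono (by simp) fun _ h => h.1

/-- The steps of the dynamic program for a pattern symbol. -/
def symbolProg : RamProg :=
  .seq (.block [.op .add 15 0 14, .load 15 15])
    (.ite (.lt 5 15) (.ite (.eq 15 7) wordProg varProg) (.seq (.move 18 15) letterProg))

theorem halts_symbolProg (hF : Fits W σ n k r inp) (hP : HasParams σ n k r x m s)
    (hR : HasRow n inp row s) (hle : ∀ j, row j ≤ n + 1) {T l i : ℕ} (hT : s.reg 10 = T)
    (hTW : T < W) (hl : s.reg 12 = l) (hln : l ≤ n) (hi : s.reg 14 = i) (hik : i < k) :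
    Halts W symbolProg s
      ((if inp (n + i) = x then l * (12 * n + (8 * r + 10) * σ + 9) else 0) + (12 * n + 8))
      (HasRow n inp (symbolRow σ n inp x l (majorityCode σ n r inp T) (inp (n + i)) row)) := by
  have hlin := hF.linear_lt
  have hk := hF.length_le
  have hiW := hF.input_lt (n + i)
  have hm : s.mem (n + i) = inp (n + i) := hR.input _ (by omega)
  have hpre : Halts W (.block [.op .add 15 0 14, .load 15 15]) s 2
      fun s' => s'.reg 15 = inp (n + i) := by
    refine Halts.of_wp ?_
    simp only [RamProg.block, RamProg.wp, BinOp.eval, RamState.setReg_reg, RamState.setReg_mem,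
      if_true, hP.r0, hi, hm]
    exact ⟨by omega, by omega, hiW, trivial⟩
  refine (((hpre.frame (L := 15) rfl).frame_mem rfl).seq (K' :=
    (if inp (n + i) = x then l * (12 * n + (8 * r + 10) * σ + 9) else 0) + (12 * n + 4) + 1 + 1)
    ?_).mono (by omega) fun _ => id
  rintro s1 ⟨⟨h15, hfr⟩, hmem⟩
  have hP1 := hP.congr (by omega) hfr
  have hR1 := hR.congr hmem
  refine Halts.ite (fun h1 => ?_) fun h1 => ?_
  · rw [RamTest.Holds, hP1.r5, h15] at h1
    refine Halts.ite (fun h2 => ?_) fun h2 => ?_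
    · rw [RamTest.Holds, hP1.r7, h15] at h2
      rw [symbolRow, if_pos h1, if_pos h2, if_pos h2]
      exact (halts_wordProg hF hP1 hR1 hle (by rw [hfr _ (by omega), hT]) hTW
        (by rw [hfr _ (by omega), hl]) hln).mono (by omega) fun _ => id
    · rw [RamTest.Holds, hP1.r7, h15] at h2
      rw [symbolRow, if_pos h1, if_neg h2, if_neg h2]
      exact (halts_varProg hF hP1 hR1 hle).mono (by omega) fun _ => id
  · rw [RamTest.Holds, hP1.r5, h15] at h1
    rw [symbolRow, if_neg h1]
    have hmove : Halts W (.move 18 15) s1 1 fun s' => s'.reg 18 = inp (n + i) := by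
      refine Halts.of_wp (p := .move 18 15) ?_
      simp only [RamProg.move, RamProg.wp, BinOp.eval, RamState.setReg_reg, if_true, hP1.r2, h15,
        mul_one]
      exact ⟨hiW, trivial⟩
    refine (((hmove.frame (L := 18) rfl).frame_mem rfl).seq (K' := 12 * n + 3) ?_).mono
      (by omega) fun _ => id
    rintro s2 ⟨⟨h18, hfr2⟩, hmem2⟩
    exact halts_letterProg hF (hP1.congr (by omega) hfr2) (hR1.congr hmem2) hle h18

def patternProg : RamProg := .forLoop 14 1 symbolProg

/-- An occurrence of `x` costs `l` letter updates together with their votes, every other symbol a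
linear pass. By `l * m ≤ n` the occurrences need at most `n` letter updates altogether, so the total
is quadratic in `n`. -/
theorem halts_patternProg (hF : Fits W σ n k r inp) (hP : HasParams σ n k r x m s)
    (hR : HasRow n inp (initRow n) s) {T l : ℕ} (hT : s.reg 10 = T)
    (hTW : T < W) (hl : s.reg 12 = l) (hln : l ≤ n)
    (hm : Nat.count (fun i => inp (n + i) = x) k ≤ m) (hlm : l * m ≤ n) :
    Halts W patternProg s
      (n * (12 * n + (8 * r + 10) * σ + 9) + n * (12 * n + 10) + 2)
      (HasRow n inp (patternRow σ n inp x l (majorityCode σ n r inp T) k)) := by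
  have hlin := hF.linear_lt
  have hk := hF.length_le
  set A := 12 * n + (8 * r + 10) * σ + 9 with hA
  have hloop := halts_forLoop (W := W) (i := 14) (b := 1) (p := symbolProg)
    (s := s) (N := k)
    (fun i s' => HasRow n inp (patternRow σ n inp x l (majorityCode σ n r inp T) i) s')
    (fun i => (if inp (n + i) = x then l * A else 0) + (12 * n + 8)) (by omega) (by omega)
    hP.r1 hP.r2 (by omega) rfl (hR.congr rfl)
    (by
      intro i hi s' hs' hfr hinv
      refine (halts_symbolProg hF (hP.congr (by omega) hfr) hinv (patternRow_le _ _ _ _ _ _)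
        (by rw [hfr _ (by omega), hT]) hTW (by rw [hfr _ (by omega), hl]) hln hs' hi).mono
        le_rfl fun s2 h2 => h2.congr rfl)
  refine hloop.mono ?_ fun _ h => h.1
  have h1 : ∑ i ∈ Finset.range k, ((if inp (n + i) = x then l * A else 0) + (12 * n + 8) + 2) =
      Nat.count (fun i => inp (n + i) = x) k * (l * A) + k * (12 * n + 10) := by
    rw [Nat.count_eq_card_filter_range]
    simp only [add_assoc]
    rw [Finset.sum_add_distrib, ← Finset.sum_filter, Finset.sum_const, Finset.sum_const,
      Finset.card_range, smul_eq_mul, smul_eq_mul]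
  rw [h1]
  have h2 : Nat.count (fun i => inp (n + i) = x) k * (l * A) ≤ n * A := by
    calc _ ≤ m * (l * A) := Nat.mul_le_mul_right _ hm
      _ = l * m * A := by ring
      _ ≤ _ := Nat.mul_le_mul_right _ hlm
  have h3 : k * (12 * n + 10) ≤ n * (12 * n + 10) := Nat.mul_le_mul_right _ hk
  omega

/-! ### The search over all candidates -/

/-- Computing the distance for one candidate; register `11` holds the best distance. -/
def candidateProg : RamProg :=
  .seq (.block [.op .mod 12 10 3, .op .mul 13 12 8])
    (.ite (.lt 13 3)
      (.seq initProg (.seq patternProg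
        (.block [.op .add 13 4 0, .load 13 13, .ite (.lt 13 11) (.move 11 13) .skip])))
      .skip)

theorem halts_candidateProg (hF : Fits W σ n k r inp) (hP : HasParams σ n k r x m s)
    (hI : ∀ i < 2 * n, s.mem i = inp i) {T : ℕ} (hT : s.reg 10 = T) (hTW : T < W)
    (hm : Nat.count (fun i => inp (n + i) = x) k ≤ m) (hmn : m ≤ n)
    (hbest : s.reg 11 = bestDist σ n r inp k x m T) :
    Halts W candidateProg s
      (n * (12 * n + (8 * r + 10) * σ + 9) + n * (12 * n + 10) + 4 * n + 20)
      fun s' => s'.reg 11 = bestDist σ n r inp k x m (T + 1) ∧ ∀ i < 2 * n, s'.mem i = inp i := by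
  have hlin := hF.linear_lt
  have hsq := hF.square_lt
  set l := T % (n + 1) with hl
  have hln : l ≤ n := Nat.lt_succ_iff.1 (Nat.mod_lt _ (Nat.succ_pos n))
  -- The product is formed before it is known to be at most `n`, so a word must have room for `(n +
  -- 1) ^ 2`.
  have hlm : l * m < W := (Nat.mul_le_mul (by omega) (by omega)).trans_lt hsq
  have hpre : Halts W (.block [.op .mod 12 10 3, .op .mul 13 12 8]) s 2
      fun s' => (s'.reg 12 = l ∧ s'.reg 13 = l * m) ∧ s'.reg 11 = bestDist σ n r inp k x m T := by
    refine Halts.of_wp ?_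
    simp only [RamProg.block, RamProg.wp, BinOp.eval, RamState.setReg_reg, Nat.reduceEqDiff,
      if_true, if_false, hP.r3, hP.r8, hT, ← hl]
    exact ⟨by omega, hlm, ⟨trivial, trivial⟩, hbest⟩
  refine (((hpre.frame (L := 11) rfl).frame_mem rfl).seq (K' :=
    n * (12 * n + (8 * r + 10) * σ + 9) + n * (12 * n + 10) + 4 * n + 17 + 1) ?_).mono
    (by omega) fun _ => id
  rintro s1 ⟨⟨⟨⟨h12, h13⟩, h11⟩, hfr⟩, hmem⟩
  have hP1 := hP.congr (by omega) hfr
  have hI1 : ∀ i < 2 * n, s1.mem i = inp i := fun i hi => by rw [hmem, hI i hi]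
  refine Halts.ite (fun h1 => ?_) fun h1 => ?_
  · rw [RamTest.Holds, h13, hP1.r3] at h1
    refine (((halts_initProg hF hP1 hI1).frame (L := 14) rfl).seq (K' :=
      n * (12 * n + (8 * r + 10) * σ + 9) + n * (12 * n + 10) + 2 + 5) ?_).mono (by omega)
      fun _ => id
    rintro s2 ⟨hR2, hfr2⟩
    have hP2 := hP1.congr (by omega) hfr2
    refine ((halts_patternProg hF hP2 hR2 (by rw [hfr2 _ (by omega), hfr _ (by omega), hT]) hTW
      (by rw [hfr2 _ (by omega), h12]) hln hm (by omega)).frame (L := 14) rfl).seq ?_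
    rintro s3 ⟨hR3, hfr3⟩
    have hP3 := hP2.congr (by omega) hfr3
    have h11' : s3.reg 11 = bestDist σ n r inp k x m T := by
      rw [hfr3 _ (by omega), hfr2 _ (by omega), h11]
    have hcand : s3.mem (2 * n + n) = candidateDist σ n r inp k x T := hR3.row n le_rfl
    have hcle : candidateDist σ n r inp k x T ≤ n + 1 := patternRow_le _ _ _ _ _ _ _
    have hb : bestDist σ n r inp k x m (T + 1) =
        min (candidateDist σ n r inp k x T) (bestDist σ n r inp k x m T) := by
      rw [bestDist, if_pos h1]
    refine (Halts.of_wp ?_).mono (K := RamProg.cost _) (by decide) fun _ => id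
    simp only [RamProg.block, RamProg.wp, RamProg.move, BinOp.eval, RamState.setReg_reg,
      RamState.setReg_mem, RamTest.Holds, Nat.reduceEqDiff, if_true, if_false, hP3.r0, hP3.r2,
      hP3.r4, h11', hcand, mul_one, hb]
    refine ⟨by omega, by omega, by omega, fun hlt => ⟨by omega, ?_, hR3.input⟩,
      fun hlt => ⟨?_, hR3.input⟩⟩
    · rw [min_eq_left hlt.le]
    · rw [min_eq_right (not_lt.1 hlt)]
  · rw [RamTest.Holds, h13, hP1.r3] at h1
    refine (Halts.of_wp (p := .skip) ?_).mono (by simp) fun _ => id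
    refine ⟨?_, hI1⟩
    rw [h11, bestDist, if_neg h1]

/-- Trying all candidates; register `9` holds their number. -/
def searchProg : RamProg := .forLoop 10 9 candidateProg

theorem halts_searchProg (hF : Fits W σ n k r inp) (hP : HasParams σ n k r x m s)
    (hI : ∀ i < 2 * n, s.mem i = inp i) {M : ℕ} (hM : s.reg 9 = M) (hMW : M < W)
    (hm : Nat.count (fun i => inp (n + i) = x) k ≤ m) (hmn : m ≤ n) (hbest : s.reg 11 = n + 1) :
    Halts W searchProg s
      (M * (n * (12 * n + (8 * r + 10) * σ + 9) + n * (12 * n + 10) + 4 * n + 22) + 2)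
      fun s' => s'.reg 11 = bestDist σ n r inp k x m M := by
  have hloop := halts_forLoop (W := W) (i := 10) (b := 9) (p := candidateProg)
    (s := s) (N := M)
    (fun T s' => s'.reg 11 = bestDist σ n r inp k x m T ∧ ∀ i < 2 * n, s'.mem i = inp i)
    (fun _ => n * (12 * n + (8 * r + 10) * σ + 9) + n * (12 * n + 10) + 4 * n + 20)
    (by omega) (by omega) hM hP.r2 hMW rfl ⟨hbest, hI⟩
    (by
      rintro T hT s' hs' hfr ⟨h11, hI'⟩
      refine (halts_candidateProg hF (hP.congr (by omega) hfr) hI' hs' (hT.trans hMW) hm hmn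
        h11).mono le_rfl fun s2 h2 => h2)
  exact hloop.mono (by simp) fun _ h => h.1.1

end Program

/-! ### Finding the repeated variable -/

/-- The number of occurrences of the symbol with code `c` in the pattern. -/
def codeCount (n k : ℕ) (inp : ℕ → ℕ) (c : ℕ) : ℕ := Nat.count (fun i => inp (n + i) = c) k

/-- The code of the last variable among the first `i` symbols that occurs more than once, and its
number of occurrences; a variable that does not occur if there is none. -/
def repeatedVar (σ n k : ℕ) (inp : ℕ → ℕ) : ℕ → ℕ × ℕ
  | 0 => (σ + 1 + n, 0)
  | i + 1 =>
    if σ < inp (n + i) then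
      if 1 < codeCount n k inp (inp (n + i)) then (inp (n + i), codeCount n k inp (inp (n + i)))
      else repeatedVar σ n k inp i
    else repeatedVar σ n k inp i

theorem symCode_injective {σ : ℕ} : Function.Injective (symCode (σ := σ)) := by
  rintro (a | x) (b | y) h <;> simp only [symCode] at h
  · exact congrArg _ (Fin.ext (by omega))
  · omega
  · omega
  · exact congrArg _ (by omega)

section Program

variable {W σ n k r x m : ℕ} {inp : ℕ → ℕ} {s : RamState}

theorem codeCount_eq {α : Pattern σ} (hα : ∀ j (hj : j < α.length), inp (n + j) = symCode α[j])
    (c : Fin σ ⊕ ℕ) : codeCount n α.length inp (symCode c) = α.count c := by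
  induction α using List.reverseRecOn with
  | nil => simp [codeCount]
  | append_singleton α b ih =>
    have hb : inp (n + α.length) = symCode b := by
      rw [hα α.length (by simp)]; simp
    have ih' := ih fun j hj => by
      rw [hα j (by rw [List.length_append]; omega), List.getElem_append_left hj]
    rw [codeCount] at ih' ⊢
    rw [List.length_append, List.length_singleton, Nat.count_succ, ih', List.count_append, hb]
    by_cases h : b = c
    · subst h
      rw [if_pos rfl, List.count_singleton_self]
    · rw [if_neg (symCode_injective.ne h), List.count_singleton, if_neg (by simpa using h)]

theorem exists_repeatedVar {α : Pattern σ}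
    (hα : ∀ j (hj : j < α.length), inp (n + j) = symCode α[j])
    (hvar : ∀ y : ℕ, Sum.inr y ∈ α → y < n) (hone : α.IsOneRepVar) :
    ∃ x, repeatedVar σ n α.length inp α.length =
        (symCode (σ := σ) (Sum.inr x), α.count (Sum.inr x)) ∧ x ≤ n ∧
      ∀ y, y ≠ x → α.count (Sum.inr y) ≤ 1 := by
  have key : ∀ i ≤ α.length, ∃ x, repeatedVar σ n α.length inp i =
        (symCode (σ := σ) (Sum.inr x), α.count (Sum.inr x)) ∧ x ≤ n ∧
      ∀ j, ∀ hj : j < α.length, j < i → ∀ y, α[j] = Sum.inr y → y ≠ x →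
        α.count (Sum.inr y) ≤ 1 := by
    intro i
    induction i with
    | zero =>
      intro _
      -- The variables of the pattern are below `n`, so `n` serves as a variable that does not
      -- occur.
      refine ⟨n, ?_, le_rfl, fun j _ hj => absurd hj (Nat.not_lt_zero j)⟩
      rw [repeatedVar, symCode, List.count_eq_zero.2]
      exact fun h => lt_irrefl _ (hvar n h)
    | succ i ih =>
      intro hi
      obtain ⟨x, hx, hxn, hx'⟩ := ih (by omega)
      rw [repeatedVar, hα i hi, codeCount_eq hα]
      rcases hc : α[i] with a | y
      · refine ⟨x, ?_, hxn, fun j hj hji y hy => ?_⟩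
        · rw [if_neg (by rw [symCode]; omega), hx]
        · rcases Nat.lt_succ_iff_lt_or_eq.1 hji with h | rfl
          · exact hx' j hj h y hy
          · rw [hc] at hy; cases hy
      · rw [if_pos (by rw [symCode]; omega)]
        by_cases hcount : 1 < α.count (Sum.inr y)
        · refine ⟨y, by rw [if_pos hcount], (hvar y (hc ▸ List.getElem_mem _)).le,
            fun j hj hji y' hy' hne => ?_⟩
          by_contra h
          -- Two variables that both occur more than once coincide, so it does not matter which
          -- occurrence is found.
          exact hne (hone y' y (not_le.1 h) hcount)
        · refine ⟨x, by rw [if_neg hcount, hx], hxn, fun j hj hji y' hy' hne => ?_⟩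
          rcases Nat.lt_succ_iff_lt_or_eq.1 hji with h | rfl
          · exact hx' j hj h y' hy' hne
          · rw [hc, Sum.inr.injEq] at hy'
            subst hy'
            exact not_lt.1 hcount
  obtain ⟨x, hx, hxn, hx'⟩ := key α.length le_rfl
  refine ⟨x, hx, hxn, fun y hy => ?_⟩
  by_cases hmem : Sum.inr y ∈ α
  · obtain ⟨j, hj, hjy⟩ := List.getElem_of_mem hmem
    exact hx' j hj hj y hjy hy
  · rw [List.count_eq_zero.2 hmem]
    exact Nat.zero_le _

def countBody : RamProg :=
  .block [.op .add 18 0 16, .load 18 18, .ite (.eq 18 15) (.op .add 17 17 2) .skip]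

/-- Counting the occurrences of the symbol at the position in register `10`. -/
def countProg : RamProg :=
  .seq (.block [.op .add 15 0 10, .load 15 15, .const 17 0]) (.forLoop 16 1 countBody)

theorem halts_countProg (hF : Fits W σ n k r inp) (hP : HasParams σ n k r x m s)
    (hI : ∀ i < 2 * n, s.mem i = inp i) {i : ℕ} (hi : s.reg 10 = i) (hik : i < k) :
    Halts W countProg s (6 * n + 5) fun s' =>
      s'.reg 15 = inp (n + i) ∧ s'.reg 17 = codeCount n k inp (inp (n + i)) := by
  have hlin := hF.linear_lt
  have hk := hF.length_le
  have hiW := hF.input_lt (n + i)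
  have hm : s.mem (n + i) = inp (n + i) := hI _ (by omega)
  have hpre : Halts W (.block [.op .add 15 0 10, .load 15 15, .const 17 0]) s 3
      fun s' => s'.reg 15 = inp (n + i) ∧ s'.reg 17 = 0 := by
    refine Halts.of_wp ?_
    simp only [RamProg.block, RamProg.wp, BinOp.eval, RamState.setReg_reg, RamState.setReg_mem,
      Nat.reduceEqDiff, if_true, if_false, hP.r0, hi, hm]
    exact ⟨by omega, by omega, hiW, by omega, trivial, trivial⟩
  refine (((hpre.frame (L := 15) rfl).frame_mem rfl).seq (K' := 6 * n + 2) ?_).mono (by omega)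
    fun _ => id
  rintro s1 ⟨⟨⟨h15, h17⟩, hfr⟩, hmem⟩
  have hP1 := hP.congr (by omega) hfr
  have hloop := halts_forLoop (W := W) (i := 16) (b := 1) (p := countBody) (s := s1) (N := k)
    (fun j s' => s'.reg 17 = Nat.count (fun j => inp (n + j) = inp (n + i)) j ∧ s'.mem = s.mem)
    (fun _ => 4) (by omega) (by omega) hP1.r1 hP1.r2 (by omega) rfl
    (by simp [h17, hmem])
    (by
      rintro j hj s' hs' hfr' ⟨h17', hmem'⟩
      have h0 : s'.reg 0 = n := by rw [hfr' _ (by omega), hP1.r0]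
      have h2 : s'.reg 2 = 1 := by rw [hfr' _ (by omega), hP1.r2]
      have h15' : s'.reg 15 = inp (n + i) := by rw [hfr' _ (by omega), h15]
      have hm1 : s.mem (n + j) = inp (n + j) := hI _ (by omega)
      have hi1 := hF.input_lt (n + j)
      have hcount : Nat.count (fun j => inp (n + j) = inp (n + i)) j ≤ j := Nat.count_le _
      have hsucc := Nat.count_succ (fun j => inp (n + j) = inp (n + i)) j
      refine (Halts.of_wp (p := countBody) ?_).mono (by decide) fun _ => id
      simp only [countBody, RamProg.block, RamProg.wp, BinOp.eval, RamState.setReg_reg,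
        RamState.setReg_mem, RamTest.Holds, Nat.reduceEqDiff, if_true, if_false, h0, h2, h15',
        h17', hs', hmem', hm1]
      refine ⟨by omega, by omega, hi1, fun heq => ⟨by omega, ?_, trivial⟩,
        fun hne => ⟨?_, trivial⟩⟩
      · rw [hsucc, if_pos heq]
      · rw [hsucc, if_neg hne, add_zero])
  refine hloop.mono (by simp; omega) ?_
  rintro s' ⟨⟨h17', -⟩, hfr'⟩
  exact ⟨by rw [hfr' _ (by omega), h15], h17'⟩

/-- Finding the repeated variable and its number of occurrences. -/
def findProg : RamProg :=
  .seq (.block [.op .add 12 5 2, .op .add 12 12 0, .const 13 0])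
    (.forLoop 10 1 (.seq countProg
      (.ite (.lt 5 15) (.ite (.lt 2 17) (.block [.move 12 15, .move 13 17]) .skip) .skip)))

theorem codeCount_le (n k : ℕ) (inp : ℕ → ℕ) (c : ℕ) : codeCount n k inp c ≤ k := Nat.count_le _

theorem halts_findProg (hF : Fits W σ n k r inp) (hP : HasParams σ n k r x m s)
    (hI : ∀ i < 2 * n, s.mem i = inp i) :
    Halts W findProg s (n * (6 * n + 11) + 5) fun s' =>
      s'.reg 12 = (repeatedVar σ n k inp k).1 ∧ s'.reg 13 = (repeatedVar σ n k inp k).2 := by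
  have hlin := hF.linear_lt
  have halp := hF.alphabet_lt
  have hk := hF.length_le
  have hpre : Halts W (.block [.op .add 12 5 2, .op .add 12 12 0, .const 13 0]) s 3
      fun s' => s'.reg 12 = σ + 1 + n ∧ s'.reg 13 = 0 := by
    refine Halts.of_wp ?_
    simp only [RamProg.block, RamProg.wp, BinOp.eval, RamState.setReg_reg,
      Nat.reduceEqDiff, if_true, if_false, hP.r0, hP.r2, hP.r5]
    exact ⟨by omega, by omega, by omega, trivial, trivial⟩
  refine (((hpre.frame (L := 12) rfl).frame_mem rfl).seq (K' := n * (6 * n + 11) + 2) ?_).mono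
    (by omega) fun _ => id
  rintro s1 ⟨⟨⟨h12, h13⟩, hfr⟩, hmem⟩
  have hP1 := hP.congr (by omega) hfr
  have hloop := halts_forLoop (W := W) (i := 10) (b := 1) (p := .seq countProg
      (.ite (.lt 5 15) (.ite (.lt 2 17) (.block [.move 12 15, .move 13 17]) .skip) .skip))
    (s := s1) (N := k)
    (fun i s' => s'.reg 12 = (repeatedVar σ n k inp i).1 ∧
      s'.reg 13 = (repeatedVar σ n k inp i).2 ∧ s'.mem = s.mem)
    (fun _ => 6 * n + 9) (by omega) (by omega) hP1.r1 hP1.r2 (by omega) rfl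
    (by simp [h12, h13, hmem, repeatedVar])
    (by
      rintro i hi s' hs' hfr' ⟨h12', h13', hmem'⟩
      have hP' := hP1.congr (by omega) hfr'
      have hcount := halts_countProg hF hP' (fun i hi => by rw [hmem', hI i hi]) hs' hi
      refine (((hcount.frame (L := 15) rfl).frame_mem rfl).seq (K' := 4) ?_).mono (by omega)
        fun _ => id
      rintro s2 ⟨⟨⟨h15, h17⟩, hfr2⟩, hmem2⟩
      have hP2 := hP'.congr (by omega) hfr2
      have h12'' : s2.reg 12 = (repeatedVar σ n k inp i).1 := by rw [hfr2 _ (by omega), h12']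
      have h13'' : s2.reg 13 = (repeatedVar σ n k inp i).2 := by rw [hfr2 _ (by omega), h13']
      have hiW := hF.input_lt (n + i)
      have hcle := codeCount_le n k inp (inp (n + i))
      refine (Halts.of_wp ?_).mono (K := RamProg.cost _) (by decide) fun _ => id
      simp only [RamProg.block, RamProg.wp, RamProg.move, BinOp.eval, RamState.setReg_reg,
        RamState.setReg_mem, RamTest.Holds, Nat.reduceEqDiff, if_true, if_false, hP2.r2, hP2.r5,
        h12'', h13'', h15, h17, mul_one, hmem2, hmem', and_true]
      rw [repeatedVar]
      refine ⟨fun h1 => ⟨fun h2 => ⟨hiW, by omega, ?_⟩, fun h2 => ?_⟩, fun h1 => ?_⟩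
      · rw [if_pos h1, if_pos h2]; exact ⟨rfl, rfl⟩
      · rw [if_pos h1, if_neg h2]; exact ⟨rfl, rfl⟩
      · rw [if_neg h1]; exact ⟨rfl, rfl⟩)
  refine hloop.mono ?_ ?_
  · simp only [Finset.sum_const, Finset.card_range, smul_eq_mul]
    have : k * (6 * n + 9 + 2) ≤ n * (6 * n + 11) := Nat.mul_le_mul_right _ hk
    omega
  · rintro s' ⟨⟨h12', h13', -⟩, -⟩
    exact ⟨h12', h13'⟩

/-! ### Initialisation and the complete program -/

/-- Setting up the constants. -/
def constProg (σ r : ℕ) : RamProg :=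
  .block [.const 2 1, .op .add 3 0 2, .op .add 4 0 0, .const 5 σ, .const 6 r, .const 9 (r + 1),
    .const 11 1]

/-- Computing the number of candidates. -/
def powerProg : RamProg := .seq (.forLoop 10 9 (.op .mul 11 11 3)) (.move 9 11)

theorem halts_powerProg (hF : Fits W σ n k r inp) (hP : HasParams σ n k r x m s)
    (h9 : s.reg 9 = r + 1) (h11 : s.reg 11 = 1) :
    Halts W powerProg s (3 * r + 6) fun s' => s'.reg 9 = (n + 1) ^ (r + 1) := by
  have hsam := hF.sample_lt
  have hpow := hF.power_lt
  have hloop := halts_forLoop (W := W) (i := 10) (b := 9) (p := .op .mul 11 11 3)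
    (s := s) (N := r + 1) (fun j s' => s'.reg 11 = (n + 1) ^ j) (fun _ => 1) (by omega) (by omega)
    h9 hP.r2 (by omega) rfl (by simp [h11])
    (by
      intro j hj s' hs' hfr h11'
      have h3 : s'.reg 3 = n + 1 := by rw [hfr _ (by omega), hP.r3]
      have hle : (n + 1) ^ (j + 1) ≤ (n + 1) ^ (r + 1) :=
        Nat.pow_le_pow_right (Nat.succ_pos n) (by omega)
      refine Halts.of_wp (p := .op .mul 11 11 3) ?_
      simp only [RamProg.wp, BinOp.eval, RamState.setReg_reg, Nat.reduceEqDiff, if_true, if_false,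
        h3, h11', ← pow_succ]
      exact ⟨by omega, trivial⟩)
  refine (hloop.seq (K' := 1) ?_).mono (by simp; omega) fun _ => id
  rintro s' ⟨h11', hfr⟩
  refine Halts.of_wp (p := .move 9 11) ?_
  have h2 : s'.reg 2 = 1 := by rw [hfr _ (by omega), hP.r2]
  simp only [RamProg.move, RamProg.wp, BinOp.eval, RamState.setReg_reg, if_true, h2, h11', mul_one]
  exact ⟨hpow, trivial⟩

/-- The approximation algorithm. -/
def approxProg (σ r : ℕ) : RamProg :=
  .seq (constProg σ r) (.seq powerProg (.seq findProg
    (.seq (.block [.move 7 12, .move 8 13, .move 11 3])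
      (.seq searchProg (.ite (.lt 11 3) (.op .add 0 11 2) (.const 0 0))))))

theorem halts_approxProg (hF : Fits W σ n k r inp) (h0 : s.reg 0 = n) (h1 : s.reg 1 = k)
    (h7 : s.reg 7 = 0) (h8 : s.reg 8 = 0) (hI : ∀ i, s.mem i = inp i)
    (hrep : repeatedVar σ n k inp k = (x, m)) (hx : x < W) (hm : codeCount n k inp x ≤ m)
    (hmn : m ≤ n) :
    Halts W (approxProg σ r) s
      (3 * r + n * (6 * n + 11) + (n + 1) ^ (r + 1) *
        (n * (12 * n + (8 * r + 10) * σ + 9) + n * (12 * n + 10) + 4 * n + 22) + 25)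
      fun s' => s'.reg 0 = if bestDist σ n r inp k x m ((n + 1) ^ (r + 1)) < n + 1 then
        bestDist σ n r inp k x m ((n + 1) ^ (r + 1)) + 1 else 0 := by
  have hlin := hF.linear_lt
  have hsam := hF.sample_lt
  have halp := hF.alphabet_lt
  set A := n * (12 * n + (8 * r + 10) * σ + 9) + n * (12 * n + 10) + 4 * n + 22 with hA
  -- The repeated variable and its count are still unknown; their registers hold `0` until
  -- `findProg` has run.
  have hconst : Halts W (constProg σ r) s 7 fun s' => (HasParams σ n k r 0 0 s' ∧
      s'.reg 9 = r + 1 ∧ s'.reg 11 = 1) := by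
    refine Halts.of_wp (p := constProg σ r) ?_
    simp only [constProg, RamProg.block, RamProg.wp, BinOp.eval, RamState.setReg_reg,
      Nat.reduceEqDiff, OfNat.zero_ne_ofNat, if_true, if_false, h0]
    refine ⟨by omega, by omega, by omega, by omega, by omega, by omega, by omega,
      ⟨?_, ?_, ?_, ?_, ?_, ?_, ?_, ?_, ?_⟩, trivial, trivial⟩ <;>
      simp [h0, h1, h7, h8, two_mul]
  refine ((hconst.frame_mem rfl).seq (K' := 3 * r + 6 + (n * (6 * n + 11) + 5 + (3 +
    (((n + 1) ^ (r + 1) * A + 2) + 2)))) ?_).mono (by omega) fun _ => id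
  rintro s1 ⟨⟨hP1, h9, h11⟩, hmem1⟩
  refine (((halts_powerProg hF hP1 h9 h11).frame (L := 9) rfl).frame_mem rfl).seq ?_
  rintro s2 ⟨⟨h9, hfr2⟩, hmem2⟩
  have hP2 := hP1.congr (by omega) hfr2
  refine (((halts_findProg hF hP2 fun i _ => by rw [hmem2, hmem1, hI i]).frame (L := 10)
    rfl).frame_mem rfl).seq ?_
  rintro s3 ⟨⟨⟨h12, h13⟩, hfr3⟩, hmem3⟩
  have hP3 := hP2.congr (by omega) hfr3
  have hmove : Halts W (.block [.move 7 12, .move 8 13, .move 11 3]) s3 3 fun s' =>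
      HasParams σ n k r x m s' ∧ s'.reg 9 = (n + 1) ^ (r + 1) ∧ s'.reg 11 = n + 1 := by
    have h9' : s3.reg 9 = (n + 1) ^ (r + 1) := by rw [hfr3 _ (by omega), h9]
    rw [hrep] at h12 h13
    refine Halts.of_wp (p := .block [.move 7 12, .move 8 13, .move 11 3]) ?_
    simp only [RamProg.block, RamProg.move, RamProg.wp, BinOp.eval, RamState.setReg_reg,
      Nat.reduceEqDiff, if_true, if_false, hP3.r2, hP3.r3, h12, h13, mul_one, h9']
    refine ⟨by omega, by omega, by omega,
      ⟨?_, ?_, ?_, ?_, ?_, ?_, ?_, ?_, ?_⟩, trivial, trivial⟩ <;>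
      simp [hP3.r0, hP3.r1, hP3.r2, hP3.r3, hP3.r4, hP3.r5, hP3.r6]
  refine (hmove.frame_mem rfl).seq ?_
  rintro s4 ⟨⟨hP4, h9, h11⟩, hmem4⟩
  refine ((halts_searchProg hF hP4 (fun i _ => by rw [hmem4, hmem3, hmem2, hmem1, hI i]) h9
    hF.power_lt hm hmn h11).frame (L := 10) rfl).seq ?_
  rintro s5 ⟨h11, hfr5⟩
  have hP5 := hP4.congr (by omega) hfr5
  refine (Halts.of_wp ?_).mono (K := RamProg.cost _) (by decide) fun _ => id
  simp only [RamProg.wp, RamTest.Holds, BinOp.eval, RamState.setReg_reg, if_true, h11, hP5.r3,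
    hP5.r2]
  refine ⟨fun hlt => ⟨by omega, ?_⟩, fun hlt => ⟨by omega, ?_⟩⟩
  · rw [if_pos hlt]
  · rw [if_neg hlt]

end Program

/-! ### The approximation algorithm -/

theorem symCode_lt {σ : ℕ} {α : Pattern σ} {w : PWord σ}
    (hvar : ∀ x : ℕ, Sum.inr x ∈ α → x < w.length) (i : ℕ) :
    (inputState α w).mem i < σ + w.length + 2 := by
  simp only [inputState, List.getD_eq_getElem?_getD]
  rcases h : ((w.map fun a => symCode (Sum.inl a)) ++ α.map symCode)[i]? with _ | c
  · simp
  · rw [Option.getD_some]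
    rcases List.mem_append.1 (List.mem_of_getElem? h) with hc | hc
    · obtain ⟨a, -, rfl⟩ := List.mem_map.1 hc
      rw [symCode]
      omega
    · obtain ⟨a | x, ha, rfl⟩ := List.mem_map.1 hc
      · rw [symCode]
        omega
      · have := hvar x ha
        rw [symCode]
        omega

/-- Since `n + 1 ≥ 2`, the bound `a + 1 ≤ (n + 1) ^ a` absorbs the constants `σ` and `r` into the
exponent, even for small `n`. -/
theorem fits_pow {σ n k r : ℕ} {inp : ℕ → ℕ} (hn : 1 ≤ n) (hk : k ≤ n)
    (hinp : ∀ i, inp i < σ + n + 2) : Fits ((n + 1) ^ (r + σ + 5)) σ n k r inp := by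
  have hpow : ∀ a, a + 1 ≤ (n + 1) ^ a := fun a => Nat.lt_pow_self (by omega)
  have hmono : ∀ {a b}, a < b → (n + 1) ^ a < (n + 1) ^ b :=
    fun h => Nat.pow_lt_pow_right (by omega) h
  have h3 : 4 * (n + 1) ≤ (n + 1) ^ 3 := by
    have : 4 ≤ (n + 1) ^ 2 := by nlinarith
    calc _ ≤ (n + 1) ^ 2 * (n + 1) := Nat.mul_le_mul_right _ this
      _ = _ := by ring
  have hσ : σ + n + 2 < (n + 1) ^ (r + σ + 5) := by
    calc σ + n + 2 < (σ + 1) * (4 * (n + 1)) := by nlinarith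
      _ ≤ (n + 1) ^ σ * (n + 1) ^ 3 := Nat.mul_le_mul (hpow σ) h3
      _ = (n + 1) ^ (σ + 3) := (pow_add _ _ _).symm
      _ < _ := hmono (by omega)
  refine ⟨hk, fun i => (hinp i).trans hσ, ?_, hσ, ?_, ?_, hmono (by omega)⟩
  · exact lt_of_lt_of_le (by omega) (h3.trans (hmono (by omega)).le)
  · calc r + 2 < (r + 1) * (4 * (n + 1)) := by nlinarith
      _ ≤ (n + 1) ^ r * (n + 1) ^ 3 := Nat.mul_le_mul (hpow r) h3
      _ = (n + 1) ^ (r + 3) := (pow_add _ _ _).symm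
      _ < _ := hmono (by omega)
  · rw [← pow_two]
    exact hmono (by omega)

theorem approxProg_time_le (σ r : ℕ) {n : ℕ} (hn : 1 ≤ n) :
    3 * r + n * (6 * n + 11) + (n + 1) ^ (r + 1) *
        (n * (12 * n + (8 * r + 10) * σ + 9) + n * (12 * n + 10) + 4 * n + 22) + 25 ≤
      (3 * r + 42 + 2 ^ (r + 1) * ((8 * r + 10) * σ + 69)) * n ^ (r + 3) := by
  have hsq : n ≤ n ^ 2 := Nat.le_self_pow (by norm_num) n
  have hsq1 : 1 ≤ n ^ 2 := Nat.one_le_pow _ _ hn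
  set B := (8 * r + 10) * σ
  have h1 : n * (12 * n + B + 9) + n * (12 * n + 10) + 4 * n + 22 ≤ (B + 69) * n ^ 2 := by
    nlinarith [Nat.mul_le_mul_left B hsq]
  -- Passing from `n + 1` to `n` costs the constant `2 ^ (r + 1)`, as `n + 1 ≤ 2 * n`.
  have h2 : (n + 1) ^ (r + 1) ≤ 2 ^ (r + 1) * n ^ (r + 1) := by
    rw [← mul_pow]
    exact Nat.pow_le_pow_left (by omega) _
  have h3 : n ^ 2 ≤ n ^ (r + 3) := Nat.pow_le_pow_right hn (by omega)
  have h4 : 3 * r + n * (6 * n + 11) + 25 ≤ (3 * r + 42) * n ^ 2 := by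
    nlinarith [Nat.mul_le_mul_left r hsq1]
  calc _ = (3 * r + n * (6 * n + 11) + 25) + (n + 1) ^ (r + 1) *
        (n * (12 * n + B + 9) + n * (12 * n + 10) + 4 * n + 22) := by ring
    _ ≤ (3 * r + 42) * n ^ (r + 3) + 2 ^ (r + 1) * n ^ (r + 1) * ((B + 69) * n ^ 2) :=
        add_le_add (h4.trans (Nat.mul_le_mul_left _ h3)) (Nat.mul_le_mul h2 h1)
    _ = _ := by ring

theorem hasApproxAlgorithm_sampleRatio (σ : ℕ) {r : ℕ} (hr : 3 ≤ r) :
    HasApproxAlgorithm σ (sampleRatio σ r) (r + 3) := by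
  refine ⟨approxProg σ r, r + σ + 5, 3 * r + 42 + 2 ^ (r + 1) * ((8 * r + 10) * σ + 69), ?_⟩
  intro α w hne hlen hvar hone
  have hn : 1 ≤ w.length := (List.length_pos_iff.2 hne).trans_le hlen
  -- The word has a letter, so an empty alphabet admits no instances.
  have hσ : 0 < σ := (w[0]'hn).pos
  have hlt := symCode_lt hvar
  have hF : Fits ((w.length + 1) ^ (r + σ + 5)) σ w.length α.length r (inputState α w).mem :=
    fits_pow hn hlen hlt
  have hinp : ∀ j (hj : j < w.length), (inputState α w).mem j = symCode (Sum.inl w[j]) := by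
    intro j hj
    simp [inputState, List.getElem?_append_left, hj]
  have hα : ∀ j (hj : j < α.length), (inputState α w).mem (w.length + j) = symCode α[j] := by
    intro j hj
    simp [inputState, hj]
  obtain ⟨x, hx, hxn, hx'⟩ := exists_repeatedVar hα hvar hone
  have hxW : symCode (σ := σ) (Sum.inr x) < (w.length + 1) ^ (r + σ + 5) := by
    have := hF.alphabet_lt
    rw [symCode]
    omega
  obtain ⟨t, s, ht, hrun, hs⟩ := halts_approxProg hF (s := inputState α w) rfl rfl rfl rfl
    (fun _ => rfl) hx hxW (codeCount_eq hα _).le (List.count_le_length.trans hlen)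
  refine ⟨t, s, ht.trans (approxProg_time_le σ r hn), hrun, ?_⟩
  rw [hs]
  exact isApproxOutput_bestDist hσ hr hinp hα hx' rfl

theorem HasApproxAlgorithm.mono {σ k : ℕ} {ρ ρ' : ℝ} (h : HasApproxAlgorithm σ ρ k)
    (hρ : ρ ≤ ρ') : HasApproxAlgorithm σ ρ' k := by
  obtain ⟨P, c, C, hP⟩ := h
  refine ⟨P, c, C, fun α w h1 h2 h3 h4 => ?_⟩
  obtain ⟨t, s, ht, hrun, hout⟩ := hP α w h1 h2 h3 h4
  refine ⟨t, s, ht, hrun, hout.imp_right ?_⟩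
  rintro ⟨h, hl, ho, hd⟩
  exact ⟨h, hl, ho, hd.trans (mul_le_mul_of_nonneg_right hρ (Nat.cast_nonneg _))⟩

/-- For fixed `σ` the denominator of the second term tends to infinity with `r`. -/
theorem exists_sampleRatio_le (σ : ℕ) {ε : ℝ} (hε : 0 < ε) :
    ∃ r : ℕ, 3 ≤ r ∧ sampleRatio σ r ≤ 1 + ε := by
  have h1 : Filter.Tendsto (fun r : ℕ => √(Real.exp 1) * (√(4 * (r : ℝ) + 1) - 3))
      Filter.atTop Filter.atTop := by
    refine Filter.Tendsto.const_mul_atTop (Real.sqrt_pos.2 (Real.exp_pos 1)) ?_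
    refine Filter.tendsto_atTop_add_const_right _ _ (Real.tendsto_sqrt_atTop.comp ?_)
    refine Filter.tendsto_atTop_add_const_right _ _ ?_
    exact tendsto_natCast_atTop_atTop.const_mul_atTop (by norm_num)
  have h2 := h1.const_div_atTop (4 * (σ : ℝ) - 4)
  obtain ⟨r, hr, hr'⟩ := ((h2.eventually_lt_const hε).and (Filter.eventually_ge_atTop 3)).exists
  exact ⟨r, hr', (min_le_right _ _).trans (by linarith)⟩

theorem mainTheorem7 (σ : ℕ) :
    (∀ r : ℕ, 3 ≤ r →
      HasApproxAlgorithm σ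
        (min 2 (1 + (4 * (σ : ℝ) - 4) /
          (Real.sqrt (Real.exp 1) * (Real.sqrt (4 * (r : ℝ) + 1) - 3))))
        (r + 3)) ∧
    (∀ ε : ℝ, 0 < ε → ∃ k : ℕ, HasApproxAlgorithm σ (1 + ε) k) := by
  refine ⟨fun r hr => hasApproxAlgorithm_sampleRatio σ hr, fun ε hε => ?_⟩
  obtain ⟨r, hr, hle⟩ := exists_sampleRatio_le σ hε
  exact ⟨r + 3, (hasApproxAlgorithm_sampleRatio σ hr).mono hle⟩
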